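/- Let $\Bbbk$ be a field of characteristic $2$, let $\tau\in\Bbbk$ be such that $x^2+x+\tau$ is irreducible over $\Bbbk$, let $\mathbb F=\Bbbk[x]/(x^2+x+\tau)$, let $\xi\in\mathbb F$ be the class of $x$, and let $n\ge 2$. Every $Z\in M_n(\mathbb F)$ is uniquely $Z=A+\xi B$ with $A,B\in M_n(\Bbbk)$. Put $$\mathcal T_1=\{A+\xi B:\ A-B,\ A+\tau B(A-B)^{-1}B\in \mathrm{GL}_n(\Bbbk)\},\qquad \mathcal T_2=\{A+\xi B:\ B,\ AB^{-1}A-A+\tau B\in \mathrm{GL}_n(\Bbbk)\}.$$ A straight-line program is a finite sequence of instructions with inputs $A,B\in M_n(\Bbbk)$; each instruction produces a scalar matrix $cI_n$ ($c\in\Bbbk$), a scalar multiple $cX$ ($c\in\Bbbk$), a sum $X+Y$, a product $XY$ or an inverse $X^{-1}$, where $X,Y$ are inputs or earlier results. It inverts a set $\mathcal S\subseteq \mathrm{GL}_n(\mathbb F)$ if for every $Z=A+\xi B\in\mathcal S$ all matrices that it inverts are invertible and two designated results $C,D$ satisfy $Z^{-1}=C+\xi D$. Its cost is the total number of its multiplications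 $XY$ and inversions $X^{-1}$ (scalar multiples are not counted). Algorithm 2 is the following. If $Z=A+\xi B\in\mathcal T_1$, compute $$X_1=(A-B)^{-1},\quad X_2=X_1B,\quad X_3=A+\tau BX_2,\quad X_4=X_3^{-1},\quad X_5=X_2X_4,$$ and return $X_4-\xi X_5$. Otherwise, if $Z\in\mathcal T_2$, compute $$X_1=B^{-1},\quad X_2=X_1A,\quad X_3=AX_2-A+\tau B,\quad X_4=X_3^{-1},\quad X_5=(X_2-I_n)X_4,$$ and return $X_5-\xi X_4$. Theorem. 1. Every $Z\in\mathcal T_1\cup\mathcal T_2$ is invertible and Algorithm 2 returns $Z^{-1}$; moreover its first branch inverts all of $\mathcal T_1$ and its second branch inverts all of $\mathcal T_2$. Each branch uses exactly two inversions and three multiplications in $M_n(\Bbbk)$. 2. This is optimal: $5$ is the least cost of a straight-line program that inverts $\mathcal T_1$, and the least cost of one that inverts $\mathcal T_2$. Also, $5$ is the least worst-case cost of an algorithm that inverts every $Z\in\mathcal T_1\cup\mathcal T_2$ by running one straight-line program if $Z\in\mathcal T_1$ and another one otherwise. 3. The least number of additions (subtractions included) in a straight-line program that inverts $\mathcal T_1$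 is $2$, and the same holds for $\mathcal T_2$. The first branch of Algorithm 2 uses two additions. The second branch uses two additions, with still two inversions and three multiplications, if $X_2-I_n$ is computed only once and $X_3$ is evaluated as $A(X_2-I_n)+\tau B$. -/

import Mathlib

noncomputable section

namespace FrobeniusInversion

/-- The polynomial `x² + x + τ`. -/
def quadPoly {k : Type*} [Field k] (τ : k) : Polynomial k :=
  Polynomial.X ^ 2 + Polynomial.X + Polynomial.C τ

/-- The quotient ring `k[x]/(x² + x + τ)`. -/
abbrev QuadExt {k : Type*} [Field k] (τ : k) : Type _ := AdjoinRoot (quadPoly τ)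

/-- The class `ξ` of `x` in `k[x]/(x² + x + τ)`. -/
def xi {k : Type*} [Field k] (τ : k) : QuadExt τ := AdjoinRoot.root (quadPoly τ)

/-- The matrix `A + ξ B` over `k[x]/(x² + x + τ)`, for `A, B ∈ M_n(k)`. -/
def combine {k : Type*} [Field k] (τ : k) {n : ℕ} (A B : Matrix (Fin n) (Fin n) k) :
    Matrix (Fin n) (Fin n) (QuadExt τ) :=
  A.map (algebraMap k (QuadExt τ)) + xi τ • B.map (algebraMap k (QuadExt τ))

/-- `T₁`: the matrices `A + ξ B` with `A - B` and `A + τ B (A - B)⁻¹ B` invertible. -/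
def T₁ {k : Type*} [Field k] (τ : k) (n : ℕ) : Set (Matrix (Fin n) (Fin n) (QuadExt τ)) :=
  {Z | ∃ A B : Matrix (Fin n) (Fin n) k, Z = combine τ A B ∧
    IsUnit (A - B) ∧ IsUnit (A + τ • (B * (A - B)⁻¹ * B))}

/-- `T₂`: the matrices `A + ξ B` with `B` and `A B⁻¹ A - A + τ B` invertible. -/
def T₂ {k : Type*} [Field k] (τ : k) (n : ℕ) : Set (Matrix (Fin n) (Fin n) (QuadExt τ)) :=
  {Z | ∃ A B : Matrix (Fin n) (Fin n) k, Z = combine τ A B ∧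
    IsUnit B ∧ IsUnit (A * B⁻¹ * A - A + τ • B)}

/-- Instructions of a straight-line program over a `k`-algebra. Registers are numbered from `0`
and every instruction writes its result to the next free register. -/
inductive Instr (k : Type*) : Type _ where
  /-- the constant `c · 1` -/
  | const (c : k) : Instr k
  /-- multiplication of register `i` by the scalar `c` -/
  | smul (c : k) (i : ℕ) : Instr k
  /-- addition of registers `i` and `j` -/
  | add (i j : ℕ) : Instr k
  /-- multiplication of registers `i` and `j`, in this order -/
  | mul (i j : ℕ) : Instr k
  /-- inversion of register `i` -/
  | inv (i : ℕ) : Instr k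

/-- Does the instruction perform an addition? -/
def Instr.isAdd {k : Type*} : Instr k → Bool
  | .add _ _ => true
  | _ => false

/-- Does the instruction perform a multiplication? -/
def Instr.isMul {k : Type*} : Instr k → Bool
  | .mul _ _ => true
  | _ => false

/-- Does the instruction perform an inversion? -/
def Instr.isInv {k : Type*} : Instr k → Bool
  | .inv _ => true
  | _ => false

open Classical in
/-- The value of an instruction in `M_n(k)` when the registers hold `s`. It is undefined (`none`)
if a register that is read does not exist, or if the matrix to be inverted is singular. -/
def Instr.exec {k : Type*} [Field k] {n : ℕ} (s : List (Matrix (Fin n) (Fin n) k)) :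
    Instr k → Option (Matrix (Fin n) (Fin n) k)
  | .const c => some (c • 1)
  | .smul c i => (s[i]?).map fun X => c • X
  | .add i j => (s[i]?).bind fun X => (s[j]?).map fun Y => X + Y
  | .mul i j => (s[i]?).bind fun X => (s[j]?).map fun Y => X * Y
  | .inv i => (s[i]?).bind fun X => if IsUnit X then some X⁻¹ else none

/-- Execution of a list of instructions; the result is the final list of registers. -/
def runCode {k : Type*} [Field k] {n : ℕ} :
    List (Instr k) → List (Matrix (Fin n) (Fin n) k) → Option (List (Matrix (Fin n) (Fin n) k))
  | [], s => some s
  | op :: ops, s => (op.exec s).bind fun X => runCode ops (s ++ [X])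

/-- A straight-line program with two output registers. -/
structure SLP (k : Type*) : Type _ where
  code : List (Instr k)
  out₁ : ℕ
  out₂ : ℕ

namespace SLP

/-- The outputs of the program for the inputs `A` (register `0`) and `B` (register `1`). -/
def eval {k : Type*} [Field k] {n : ℕ} (Γ : SLP k) (A B : Matrix (Fin n) (Fin n) k) :
    Option (Matrix (Fin n) (Fin n) k × Matrix (Fin n) (Fin n) k) :=
  (runCode Γ.code [A, B]).bind fun s =>
    (s[Γ.out₁]?).bind fun C => (s[Γ.out₂]?).map fun D => (C, D)

/-- Number of additions. -/
def numAdd {k : Type*} (Γ : SLP k) : ℕ := Γ.code.countP Instr.isAdd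

/-- Number of multiplications; multiplications by scalars of `k` are not counted. -/
def numMul {k : Type*} (Γ : SLP k) : ℕ := Γ.code.countP Instr.isMul

/-- Number of inversions. -/
def numInv {k : Type*} (Γ : SLP k) : ℕ := Γ.code.countP Instr.isInv

/-- Total number of inversions and multiplications. -/
def cost {k : Type*} (Γ : SLP k) : ℕ := Γ.numInv + Γ.numMul

/-- The program inverts every `Z = A + ξ B` in `S`: on the inputs `A, B` it is defined and outputs
the `C, D` with `Z⁻¹ = C + ξ D`. -/
def InvertsOn {k : Type*} [Field k] (Γ : SLP k) (τ : k) {n : ℕ}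
    (S : Set (Matrix (Fin n) (Fin n) (QuadExt τ))) : Prop :=
  ∀ A B : Matrix (Fin n) (Fin n) k, combine τ A B ∈ S →
    IsUnit (combine τ A B) ∧
      ∃ C D, Γ.eval A B = some (C, D) ∧ combine τ C D = (combine τ A B)⁻¹

end SLP

/-- An algorithm that tests whether `Z ∈ T₁` and then runs one of two straight-line programs. -/
structure BranchingSLP (k : Type*) : Type _ where
  onT₁ : SLP k
  onT₂ : SLP k

namespace BranchingSLP

open Classical in
/-- If `Z = A + ξ B` lies in `T₁`, run the first program; else, if it lies in `T₂`, run the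
second one. -/
def eval {k : Type*} [Field k] {n : ℕ} (P : BranchingSLP k) (τ : k)
    (A B : Matrix (Fin n) (Fin n) k) :
    Option (Matrix (Fin n) (Fin n) k × Matrix (Fin n) (Fin n) k) :=
  if combine τ A B ∈ T₁ τ n then P.onT₁.eval A B
  else if combine τ A B ∈ T₂ τ n then P.onT₂.eval A B
  else none

/-- Number of inversions and multiplications in the worst case. -/
def cost {k : Type*} (P : BranchingSLP k) : ℕ := max P.onT₁.cost P.onT₂.cost

/-- The algorithm inverts every `Z = A + ξ B` in `T₁ ∪ T₂`. -/
def Inverts {k : Type*} [Field k] (P : BranchingSLP k) (τ : k) (n : ℕ) : Prop :=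
  ∀ A B : Matrix (Fin n) (Fin n) k, combine τ A B ∈ T₁ τ n ∪ T₂ τ n →
    IsUnit (combine τ A B) ∧
      ∃ C D, P.eval τ A B = some (C, D) ∧ combine τ C D = (combine τ A B)⁻¹

end BranchingSLP

/-- The branch for `T₁`: `X₁ = (A - B)⁻¹`, `X₂ = X₁ B`, `X₃ = A + τ B X₂`, `X₄ = X₃⁻¹`,
`X₅ = X₂ X₄`, output `X₄ - ξ X₅`. -/
def progT₁ {k : Type*} [Field k] (τ : k) : SLP k where
  code :=
    [ .smul (-1) 1, -- 2: `-B`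
      .add 0 2, -- 3: `A - B`
      .inv 3, -- 4: `X₁`
      .mul 4 1, -- 5: `X₂`
      .mul 1 5, -- 6: `B X₂`
      .smul τ 6, -- 7: `τ B X₂`
      .add 0 7, -- 8: `X₃`
      .inv 8, -- 9: `X₄`
      .mul 5 9, -- 10: `X₅`
      .smul (-1) 10 ] -- 11: `-X₅`
  out₁ := 9
  out₂ := 11

/-- The branch for `T₂`: `X₁ = B⁻¹`, `X₂ = X₁ A`, `X₃ = A X₂ - A + τ B`, `X₄ = X₃⁻¹`,
`X₅ = (X₂ - 1) X₄`, output `X₅ - ξ X₄`. -/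
def progT₂ {k : Type*} [Field k] (τ : k) : SLP k where
  code :=
    [ .inv 1, -- 2: `X₁`
      .mul 2 0, -- 3: `X₂`
      .mul 0 3, -- 4: `A X₂`
      .smul (-1) 0, -- 5: `-A`
      .add 4 5, -- 6: `A X₂ - A`
      .smul τ 1, -- 7: `τ B`
      .add 6 7, -- 8: `X₃`
      .inv 8, -- 9: `X₄`
      .const (-1), -- 10: `-1`
      .add 3 10, -- 11: `X₂ - 1`
      .mul 11 9, -- 12: `X₅`
      .smul (-1) 9 ] -- 13: `-X₄`
  out₁ := 12
  out₂ := 13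

/-- The same branch, with `X₂ - 1` computed once and `X₃` evaluated as `A (X₂ - 1) + τ B`. -/
def progT₂' {k : Type*} [Field k] (τ : k) : SLP k where
  code :=
    [ .inv 1, -- 2: `X₁`
      .mul 2 0, -- 3: `X₂`
      .const (-1), -- 4: `-1`
      .add 3 4, -- 5: `X₂ - 1`
      .mul 0 5, -- 6: `A (X₂ - 1)`
      .smul τ 1, -- 7: `τ B`
      .add 6 7, -- 8: `X₃`
      .inv 8, -- 9: `X₄`
      .mul 5 9, -- 10: `X₅`
      .smul (-1) 9 ] -- 11: `-X₄`
  out₁ := 10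
  out₂ := 11

/-- The second Frobenius inversion algorithm. -/
def frobeniusInversion {k : Type*} [Field k] (τ : k) : BranchingSLP k where
  onT₁ := progT₁ τ
  onT₂ := progT₂ τ

end FrobeniusInversion

end

/-!
An inverse computed at finitely many points is an inverse in the product of the matrix algebras, so
a program that inverts `T₁` or `T₂` may be run in any `k`-algebra that embeds into such a product.
There additions and scalar multiples are free, and a program of cost `m` is a chain of `m` subspaces
starting from the span of `1`, `A`, `B`, each adjoining one product or inverse.
If `m = 4`, the last step adds a single dimension, so a nontrivial combination of the two components
of the inverse is already reached in three steps.

If `k` has at least four elements, evaluate at the commuting inputs `A = v x`, `B = x` in the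
quadratic extension: the combination becomes `(α v + β) / ((v² - v + τ) x)`, and its pole at the
root `v = θ` of the denominator cannot be produced by three steps. If `k` has two elements, a finite
search at seventeen pairs of `2 × 2` matrices, run by the kernel, refutes all chains of three steps.

With at most one addition every result is a monomial in the inputs, that one sum and inverses of
these; evaluating such monomials at a few `2 × 2` matrices, some of them nilpotent, shows that they
do not contain both components of the inverse.
-/

noncomputable section

namespace FrobeniusInversion

section FrobeniusIdentities

variable {k S : Type*} [Field k] [Ring S] [Algebra k S] {τ : k} {a b r e : S}

theorem mul_sub_smul_mul_eq_one_T₁ (he : (a + τ • (b * r * b)) * e = 1) :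
    a * e - τ • (b * -(r * b * e)) = 1 := by
  simpa only [add_mul, smul_mul_assoc, mul_neg, smul_neg, sub_neg_eq_add, mul_assoc] using he

theorem mul_add_mul_sub_mul_eq_zero_T₁ (hr : (a - b) * r = 1) (e : S) :
    a * -(r * b * e) + b * e - b * -(r * b * e) = 0 := by
  have h : (a - b) * r * (b * e) = b * e := by rw [hr, one_mul]
  simp only [sub_mul, mul_assoc] at h
  simp only [mul_neg, mul_assoc]
  linear_combination (norm := abel) -h

theorem mul_sub_smul_mul_eq_one_T₂ (he : (a * r * a - a + τ • b) * e = 1) :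
    a * ((r * a - 1) * e) - τ • (b * -e) = 1 := by
  simpa only [add_mul, sub_mul, mul_sub, smul_mul_assoc, mul_neg, smul_neg, sub_neg_eq_add,
    mul_assoc, one_mul] using he

theorem mul_add_mul_sub_mul_eq_zero_T₂ (hr : b * r = 1) (e : S) :
    a * -e + b * ((r * a - 1) * e) - b * -e = 0 := by
  have h : b * r * (a * e) = a * e := by rw [hr, one_mul]
  simp only [mul_assoc] at h
  simp only [mul_neg, mul_assoc, sub_mul, mul_sub, one_mul]
  linear_combination (norm := abel) h

end FrobeniusIdentities

section Combine

variable {k : Type*} [Field k] {τ : k}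

theorem xi_mul_xi (τ : k) : xi τ * xi τ = -xi τ - algebraMap k (QuadExt τ) τ := by
  have h : AdjoinRoot.mk (quadPoly τ) (Polynomial.X ^ 2 + Polynomial.X + Polynomial.C τ) = 0 :=
    AdjoinRoot.mk_self
  have h' : xi τ ^ 2 + xi τ + algebraMap k (QuadExt τ) τ = 0 := by
    simpa [xi, AdjoinRoot.algebraMap_eq] using h
  linear_combination h'

theorem natDegree_quadPoly (τ : k) : (quadPoly τ).natDegree = 2 := by
  unfold quadPoly
  compute_degree!

theorem ne_zero_of_irreducible_quadPoly (hf : Irreducible (quadPoly τ)) : τ ≠ 0 := by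
  rintro rfl
  have hroot : (quadPoly (0 : k)).IsRoot 0 := by simp [quadPoly]
  have hdeg : (quadPoly (0 : k)).natDegree = 1 := Polynomial.natDegree_eq_of_degree_eq_some
    (Polynomial.degree_eq_one_of_irreducible_of_root hf hroot)
  rw [natDegree_quadPoly] at hdeg
  omega

theorem algebraMap_add_xi_mul_inj {x y x' y' : k} :
    algebraMap k (QuadExt τ) x + xi τ * algebraMap k (QuadExt τ) y =
      algebraMap k (QuadExt τ) x' + xi τ * algebraMap k (QuadExt τ) y' ↔ x = x' ∧ y = y' := by
  refine ⟨fun h => ?_, by rintro ⟨rfl, rfl⟩; rfl⟩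
  let p : Polynomial k := Polynomial.C (y - y') * Polynomial.X + Polynomial.C (x - x')
  have hp : AdjoinRoot.mk (quadPoly τ) p = 0 := by
    simp only [p, map_add, map_mul, map_sub, AdjoinRoot.mk_C, AdjoinRoot.mk_X]
    simp only [xi, AdjoinRoot.algebraMap_eq] at h
    linear_combination h
  have hdeg : p.natDegree < (quadPoly τ).natDegree :=
    Polynomial.natDegree_linear_le.trans_lt (by rw [natDegree_quadPoly]; exact one_lt_two)
  have hp₀ : p = 0 := Polynomial.eq_zero_of_dvd_of_natDegree_lt (AdjoinRoot.mk_eq_zero.1 hp) hdeg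
  have h₀ : x - x' = 0 := by simpa [p] using congrArg (Polynomial.coeff · 0) hp₀
  have h₁ : y - y' = 0 := by
    simpa [p, Polynomial.coeff_C] using congrArg (Polynomial.coeff · 1) hp₀
  exact ⟨sub_eq_zero.1 h₀, sub_eq_zero.1 h₁⟩

variable {n : ℕ} {A B C D R E : Matrix (Fin n) (Fin n) k}

theorem combine_inj : combine τ A B = combine τ C D ↔ A = C ∧ B = D := by
  refine ⟨fun h => ?_, by rintro ⟨rfl, rfl⟩; rfl⟩
  have hij (i j) : A i j = C i j ∧ B i j = D i j :=
    algebraMap_add_xi_mul_inj.1 (by simpa [combine] using congrFun (congrFun h i) j)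
  exact ⟨Matrix.ext fun i j => (hij i j).1, Matrix.ext fun i j => (hij i j).2⟩

theorem combine_mul (A B C D : Matrix (Fin n) (Fin n) k) :
    combine τ A B * combine τ C D =
      combine τ (A * C - τ • (B * D)) (A * D + B * C - B * D) := by
  have hτ (M : Matrix (Fin n) (Fin n) k) : (τ • M).map (algebraMap k (QuadExt τ)) =
      algebraMap k (QuadExt τ) τ • M.map (algebraMap k (QuadExt τ)) := by
    ext i j
    simp
  simp only [combine, Matrix.map_sub _ (map_sub (algebraMap k (QuadExt τ))),
    Matrix.map_add _ (map_add (algebraMap k (QuadExt τ))), Matrix.map_mul, hτ, add_mul, mul_add,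
    smul_mul_assoc, mul_smul_comm]
  match_scalars <;> first | ring1 | linear_combination xi_mul_xi τ

theorem combine_one_zero : combine τ (1 : Matrix (Fin n) (Fin n) k) 0 = 1 := by
  simp [combine]

theorem isUnit_combine_and_eq_inv (h₁ : A * C - τ • (B * D) = 1)
    (h₂ : A * D + B * C - B * D = 0) :
    IsUnit (combine τ A B) ∧ combine τ C D = (combine τ A B)⁻¹ := by
  have h : combine τ A B * combine τ C D = 1 := by
    rw [combine_mul, h₁, h₂, combine_one_zero]
  exact ⟨.of_mul_eq_one _ h, (Matrix.inv_eq_right_inv h).symm⟩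

theorem combine_mem_T₁ :
    combine τ A B ∈ T₁ τ n ↔ IsUnit (A - B) ∧ IsUnit (A + τ • (B * (A - B)⁻¹ * B)) := by
  refine ⟨?_, fun h => ⟨A, B, rfl, h⟩⟩
  rintro ⟨A', B', h, h'⟩
  obtain ⟨rfl, rfl⟩ := combine_inj.1 h
  exact h'

theorem combine_mem_T₂ :
    combine τ A B ∈ T₂ τ n ↔ IsUnit B ∧ IsUnit (A * B⁻¹ * A - A + τ • B) := by
  refine ⟨?_, fun h => ⟨A, B, rfl, h⟩⟩
  rintro ⟨A', B', h, h'⟩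
  obtain ⟨rfl, rfl⟩ := combine_inj.1 h
  exact h'

theorem combine_inv_T₁ (hR : (A - B) * R = 1) (hE : (A + τ • (B * R * B)) * E = 1) :
    IsUnit (combine τ A B) ∧ combine τ E (-(R * B * E)) = (combine τ A B)⁻¹ :=
  isUnit_combine_and_eq_inv (mul_sub_smul_mul_eq_one_T₁ hE) (mul_add_mul_sub_mul_eq_zero_T₁ hR E)

theorem combine_inv_T₂ (hR : B * R = 1) (hE : (A * R * A - A + τ • B) * E = 1) :
    IsUnit (combine τ A B) ∧ combine τ ((R * A - 1) * E) (-E) = (combine τ A B)⁻¹ :=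
  isUnit_combine_and_eq_inv (mul_sub_smul_mul_eq_one_T₂ hE) (mul_add_mul_sub_mul_eq_zero_T₂ hR E)

end Combine

section Programs

variable {k : Type*} [Field k] {τ : k} {n : ℕ}

theorem progT₁_invertsOn (τ : k) : (progT₁ τ).InvertsOn τ (T₁ τ n) := by
  intro A B h
  obtain ⟨h₁, h₂⟩ := combine_mem_T₁.1 h
  obtain ⟨hunit, hinv⟩ := combine_inv_T₁ (τ := τ)
    (Matrix.mul_nonsing_inv _ ((Matrix.isUnit_iff_isUnit_det _).1 h₁))
    (Matrix.mul_nonsing_inv _ ((Matrix.isUnit_iff_isUnit_det _).1 h₂))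
  refine ⟨hunit, _, _, ?_, hinv⟩
  have hX₃ : A + τ • (B * ((A - B)⁻¹ * B)) = A + τ • (B * (A - B)⁻¹ * B) := by rw [mul_assoc]
  simp [SLP.eval, progT₁, runCode, Instr.exec, ← sub_eq_add_neg, h₁, hX₃, h₂]

theorem progT₂_invertsOn (τ : k) : (progT₂ τ).InvertsOn τ (T₂ τ n) := by
  intro A B h
  obtain ⟨h₁, h₂⟩ := combine_mem_T₂.1 h
  obtain ⟨hunit, hinv⟩ := combine_inv_T₂ (τ := τ)
    (Matrix.mul_nonsing_inv _ ((Matrix.isUnit_iff_isUnit_det _).1 h₁))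
    (Matrix.mul_nonsing_inv _ ((Matrix.isUnit_iff_isUnit_det _).1 h₂))
  refine ⟨hunit, _, _, ?_, hinv⟩
  have hX₃ : A * (B⁻¹ * A) - A + τ • B = A * B⁻¹ * A - A + τ • B := by rw [mul_assoc]
  simp [SLP.eval, progT₂, runCode, Instr.exec, ← sub_eq_add_neg, h₁, hX₃, h₂]

theorem progT₂'_invertsOn (τ : k) : (progT₂' τ).InvertsOn τ (T₂ τ n) := by
  intro A B h
  obtain ⟨h₁, h₂⟩ := combine_mem_T₂.1 h
  obtain ⟨hunit, hinv⟩ := combine_inv_T₂ (τ := τ)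
    (Matrix.mul_nonsing_inv _ ((Matrix.isUnit_iff_isUnit_det _).1 h₁))
    (Matrix.mul_nonsing_inv _ ((Matrix.isUnit_iff_isUnit_det _).1 h₂))
  refine ⟨hunit, _, _, ?_, hinv⟩
  have hX₃ : A * (B⁻¹ * A - 1) + τ • B = A * B⁻¹ * A - A + τ • B := by
    rw [mul_sub, mul_one, mul_assoc]
  simp [SLP.eval, progT₂', runCode, Instr.exec, ← sub_eq_add_neg, h₁, hX₃, h₂]

theorem frobeniusInversion_inverts (τ : k) : (frobeniusInversion τ).Inverts τ n := by
  intro A B h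
  by_cases h₁ : combine τ A B ∈ T₁ τ n
  · simpa [BranchingSLP.eval, h₁, frobeniusInversion] using progT₁_invertsOn τ A B h₁
  · have h₂ : combine τ A B ∈ T₂ τ n := h.resolve_left h₁
    simpa [BranchingSLP.eval, h₁, h₂, frobeniusInversion] using progT₂_invertsOn τ A B h₂

theorem BranchingSLP.Inverts.onT₁ {P : BranchingSLP k} (hP : P.Inverts τ n) :
    P.onT₁.InvertsOn τ (T₁ τ n) := by
  intro A B h
  simpa [BranchingSLP.eval, h] using hP A B (Or.inl h)

end Programs

section RunIn

variable {k S S' : Type*} [Field k] [Ring S] [Algebra k S] [Ring S'] [Algebra k S']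

/-- `x` is the value of an instruction in the `k`-algebra `S` when the registers hold `s`. -/
def ExecIn (s : List S) : Instr k → S → Prop
  | .const c, x => x = c • 1
  | .smul c i, x => ∃ y, s[i]? = some y ∧ x = c • y
  | .add i j, x => ∃ y z, s[i]? = some y ∧ s[j]? = some z ∧ x = y + z
  | .mul i j, x => ∃ y z, s[i]? = some y ∧ s[j]? = some z ∧ x = y * z
  | .inv i, x => ∃ y, s[i]? = some y ∧ y * x = 1 ∧ x * y = 1

/-- Running the code in the `k`-algebra `S` leads from the registers `s` to the registers `t`. -/
inductive RunIn : List (Instr k) → List S → List S → Prop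
  | nil (s : List S) : RunIn [] s s
  | cons {op : Instr k} {ops : List (Instr k)} {s t : List S} {x : S} :
      ExecIn s op x → RunIn ops (s ++ [x]) t → RunIn (op :: ops) s t

theorem ExecIn.map (ψ : S →ₐ[k] S') {s : List S} {op : Instr k} {x : S} (h : ExecIn s op x) :
    ExecIn (s.map ψ) op (ψ x) := by
  cases op with
  | const c =>
    obtain rfl : x = c • 1 := h
    simp [ExecIn]
  | smul c i =>
    obtain ⟨y, hy, rfl⟩ := h
    exact ⟨ψ y, by simp [hy], by simp⟩
  | add i j =>
    obtain ⟨y, z, hy, hz, rfl⟩ := h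
    exact ⟨ψ y, ψ z, by simp [hy], by simp [hz], by simp⟩
  | mul i j =>
    obtain ⟨y, z, hy, hz, rfl⟩ := h
    exact ⟨ψ y, ψ z, by simp [hy], by simp [hz], by simp⟩
  | inv i =>
    obtain ⟨y, hy, h₁, h₂⟩ := h
    exact ⟨ψ y, by simp [hy], by rw [← map_mul, h₁, map_one], by rw [← map_mul, h₂, map_one]⟩

theorem RunIn.map (ψ : S →ₐ[k] S') {code : List (Instr k)} {s t : List S}
    (h : RunIn code s t) : RunIn code (s.map ψ) (t.map ψ) := by
  induction h with
  | nil s => exact .nil _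
  | cons hx _ ih => exact .cons (hx.map ψ) (by simpa using ih)

end RunIn

section FaithfulFamily

variable {k S Ω : Type*} [Field k] [Ring S] [Algebra k S] {n : ℕ}

/-- A family of matrix representations of `S` that together detect equality and invertibility.
A program that is defined on all images of an input in `S` can then be run in `S` itself. -/
structure IsFaithfulFamily (φ : Ω → S →ₐ[k] Matrix (Fin n) (Fin n) k) : Prop where
  ext : ∀ {x y : S}, (∀ ω, φ ω x = φ ω y) → x = y
  isUnit : ∀ {x : S}, (∀ ω, IsUnit (φ ω x)) → IsUnit x

theorem IsFaithfulFamily.pi_single {ι : S →ₐ[k] Matrix (Fin n) (Fin n) k}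
    (hinj : Function.Injective ι) (hunit : ∀ x, IsUnit (ι x) → IsUnit x) :
    IsFaithfulFamily fun ω : Ω => ι.comp (Pi.evalAlgHom k (fun _ : Ω => S) ω) where
  ext h := funext fun ω => hinj (h ω)
  isUnit h := Pi.isUnit_iff.2 fun ω => hunit _ (h ω)

variable [Nonempty Ω] {φ : Ω → S →ₐ[k] Matrix (Fin n) (Fin n) k}

theorem IsFaithfulFamily.exists_execIn (hφ : IsFaithfulFamily φ) (op : Instr k) (s : List S)
    (h : ∀ ω, ∃ X, op.exec (s.map (φ ω)) = some X) :
    ∃ x, ExecIn s op x ∧ ∀ ω, op.exec (s.map (φ ω)) = some (φ ω x) := by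
  obtain ⟨X₀, h₀⟩ := h (Classical.arbitrary Ω)
  cases op with
  | const c => exact ⟨c • 1, rfl, fun ω => by simp [Instr.exec]⟩
  | smul c i =>
    obtain ⟨y, hy, -⟩ : ∃ y, s[i]? = some y ∧ _ := by simpa [Instr.exec] using h₀
    exact ⟨c • y, ⟨y, hy, rfl⟩, fun ω => by simp [Instr.exec, hy]⟩
  | add i j =>
    obtain ⟨y, hy, z, hz, -⟩ : ∃ y, s[i]? = some y ∧ ∃ z, s[j]? = some z ∧ _ := by
      simpa [Instr.exec, Option.bind_eq_some_iff] using h₀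
    exact ⟨y + z, ⟨y, z, hy, hz, rfl⟩, fun ω => by simp [Instr.exec, hy, hz]⟩
  | mul i j =>
    obtain ⟨y, hy, z, hz, -⟩ : ∃ y, s[i]? = some y ∧ ∃ z, s[j]? = some z ∧ _ := by
      simpa [Instr.exec, Option.bind_eq_some_iff] using h₀
    exact ⟨y * z, ⟨y, z, hy, hz, rfl⟩, fun ω => by simp [Instr.exec, hy, hz]⟩
  | inv i =>
    obtain ⟨y, hy, -⟩ : ∃ y, s[i]? = some y ∧ _ := by
      simpa [Instr.exec, Option.bind_eq_some_iff] using h₀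
    have hunit (ω) : IsUnit (φ ω y) := by
      by_contra hc
      simpa [Instr.exec, hy, hc] using h ω
    obtain ⟨u, rfl⟩ := hφ.isUnit hunit
    refine ⟨(u⁻¹ : Sˣ), ⟨u, hy, u.mul_inv, u.inv_mul⟩, fun ω => ?_⟩
    have hinv : (φ ω u)⁻¹ = φ ω (u⁻¹ : Sˣ) :=
      Matrix.inv_eq_right_inv (by rw [← map_mul, u.mul_inv, map_one])
    simp [Instr.exec, hy, hunit ω, hinv]

theorem IsFaithfulFamily.exists_runIn (hφ : IsFaithfulFamily φ) (code : List (Instr k))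
    (s : List S) (h : ∀ ω, ∃ t, runCode code (s.map (φ ω)) = some t) :
    ∃ t, RunIn code s t ∧ ∀ ω, runCode code (s.map (φ ω)) = some (t.map (φ ω)) := by
  induction code generalizing s with
  | nil => exact ⟨s, .nil s, fun _ => rfl⟩
  | cons op ops ih =>
    obtain ⟨x, hx, hexec⟩ := hφ.exists_execIn op s fun ω =>
      let ⟨_, ht⟩ := h ω
      let ⟨X, hX, _⟩ := Option.bind_eq_some_iff.1 ht
      ⟨X, hX⟩
    have hrun (ω) : runCode (op :: ops) (s.map (φ ω)) = runCode ops ((s ++ [x]).map (φ ω)) := by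
      simp [runCode, hexec ω]
    obtain ⟨t, ht, ht'⟩ := ih (s ++ [x]) fun ω => hrun ω ▸ h ω
    exact ⟨t, .cons hx ht, fun ω => by rw [hrun, ht']⟩

variable {Γ : SLP k} {τ : k} {a b : S}

theorem SLP.InvertsOn.exists_runIn {T : Set (Matrix (Fin n) (Fin n) (QuadExt τ))}
    (hΓ : Γ.InvertsOn τ T) (hφ : IsFaithfulFamily φ) {c d : S}
    (hmem : ∀ ω, combine τ (φ ω a) (φ ω b) ∈ T)
    (h₁ : a * c - τ • (b * d) = 1) (h₂ : a * d + b * c - b * d = 0) :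
    ∃ t, RunIn Γ.code [a, b] t ∧ c ∈ t ∧ d ∈ t := by
  have heval (ω) : Γ.eval (φ ω a) (φ ω b) = some (φ ω c, φ ω d) := by
    obtain ⟨-, C, D, hev, hCD⟩ := hΓ _ _ (hmem ω)
    have h₁' : φ ω a * φ ω c - τ • (φ ω b * φ ω d) = 1 := by simpa using congrArg (φ ω) h₁
    have h₂' : φ ω a * φ ω d + φ ω b * φ ω c - φ ω b * φ ω d = 0 := by
      simpa using congrArg (φ ω) h₂
    obtain ⟨rfl, rfl⟩ := combine_inj.1 (hCD.trans (isUnit_combine_and_eq_inv h₁' h₂').2.symm)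
    exact hev
  obtain ⟨t, ht, hrun⟩ := hφ.exists_runIn Γ.code [a, b] fun ω =>
    let ⟨t, ht, _⟩ := Option.bind_eq_some_iff.1 (heval ω)
    ⟨t, ht⟩
  have hout (ω) : ∃ f, t[Γ.out₁]? = some f ∧ ∃ g, t[Γ.out₂]? = some g ∧
      φ ω f = φ ω c ∧ φ ω g = φ ω d := by
    have hrun' : runCode Γ.code [φ ω a, φ ω b] = some (t.map (φ ω)) := hrun ω
    simpa [SLP.eval, hrun', Option.bind_eq_some_iff] using heval ω
  obtain ⟨f, hf, g, hg, -⟩ := hout (Classical.arbitrary Ω)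
  have hfc : f = c := hφ.ext fun ω => by
    obtain ⟨f', hf', _, _, h, -⟩ := hout ω
    rwa [← Option.some.inj (hf.symm.trans hf')] at h
  have hgd : g = d := hφ.ext fun ω => by
    obtain ⟨_, _, g', hg', -, h⟩ := hout ω
    rwa [← Option.some.inj (hg.symm.trans hg')] at h
  exact ⟨t, ht, hfc ▸ List.mem_of_getElem? hf, hgd ▸ List.mem_of_getElem? hg⟩

variable {r e : S}

theorem SLP.InvertsOn.exists_runIn_T₁ (hΓ : Γ.InvertsOn τ (T₁ τ n)) (hφ : IsFaithfulFamily φ)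
    (hr : (a - b) * r = 1) (he : (a + τ • (b * r * b)) * e = 1) :
    ∃ t, RunIn Γ.code [a, b] t ∧ e ∈ t ∧ -(r * b * e) ∈ t := by
  refine hΓ.exists_runIn hφ (fun ω => combine_mem_T₁.2 ?_) (mul_sub_smul_mul_eq_one_T₁ he)
    (mul_add_mul_sub_mul_eq_zero_T₁ hr e)
  have hrω : (φ ω a - φ ω b) * φ ω r = 1 := by simpa using congrArg (φ ω) hr
  have heω : (φ ω a + τ • (φ ω b * φ ω r * φ ω b)) * φ ω e = 1 := by
    simpa using congrArg (φ ω) he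
  rw [Matrix.inv_eq_right_inv hrω]
  exact ⟨.of_mul_eq_one _ hrω, .of_mul_eq_one _ heω⟩

theorem SLP.InvertsOn.exists_runIn_T₂ (hΓ : Γ.InvertsOn τ (T₂ τ n)) (hφ : IsFaithfulFamily φ)
    (hr : b * r = 1) (he : (a * r * a - a + τ • b) * e = 1) :
    ∃ t, RunIn Γ.code [a, b] t ∧ (r * a - 1) * e ∈ t ∧ -e ∈ t := by
  refine hΓ.exists_runIn hφ (fun ω => combine_mem_T₂.2 ?_) (mul_sub_smul_mul_eq_one_T₂ he)
    (mul_add_mul_sub_mul_eq_zero_T₂ hr e)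
  have hrω : φ ω b * φ ω r = 1 := by simpa using congrArg (φ ω) hr
  have heω : (φ ω a * φ ω r * φ ω a - φ ω a + τ • φ ω b) * φ ω e = 1 := by
    simpa using congrArg (φ ω) he
  rw [Matrix.inv_eq_right_inv hrω]
  exact ⟨.of_mul_eq_one _ hrω, .of_mul_eq_one _ heω⟩

end FaithfulFamily

section Block

variable {k S : Type*} [Field k] [Ring S] [Algebra k S] {l : ℕ}

/-- The block diagonal representation of `S × M_m(k)` on `kˡ⁺ᵐ`, for `S` acting on `kˡ`. It
transfers problems about `S` from `l × l` matrices to larger ones. -/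
def blockHom (ι : S →ₐ[k] Matrix (Fin l) (Fin l) k) (m : ℕ) :
    S × Matrix (Fin m) (Fin m) k →ₐ[k] Matrix (Fin (l + m)) (Fin (l + m)) k :=
  (Matrix.reindexAlgEquiv k k finSumFinEquiv).toAlgHom.comp
    (AlgHom.ofLinearMap
      { toFun := fun x => Matrix.fromBlocks (ι x.1) 0 0 x.2
        map_add' := fun x y => by simp [Matrix.fromBlocks_add]
        map_smul' := fun c x => by simp [Matrix.fromBlocks_smul] }
      (by simp) (fun x y => by simp [Matrix.fromBlocks_multiply]))

theorem blockHom_inj {ι : S →ₐ[k] Matrix (Fin l) (Fin l) k} {m : ℕ}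
    {x y : S × Matrix (Fin m) (Fin m) k} :
    blockHom ι m x = blockHom ι m y ↔ ι x.1 = ι y.1 ∧ x.2 = y.2 := by
  refine (Matrix.reindexAlgEquiv k k finSumFinEquiv).injective.eq_iff.trans
    (Matrix.fromBlocks_inj.trans ?_)
  simp

theorem isUnit_blockHom {ι : S →ₐ[k] Matrix (Fin l) (Fin l) k} {m : ℕ}
    {x : S × Matrix (Fin m) (Fin m) k} :
    IsUnit (blockHom ι m x) ↔ IsUnit (ι x.1) ∧ IsUnit x.2 :=
  (MulEquiv.isUnit_map (Matrix.reindexAlgEquiv k k (finSumFinEquiv (m := l) (n := m)))).trans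
    Matrix.isUnit_fromBlocks_zero₂₁

variable {Ω : Type*} [Nonempty Ω] {φ : Ω → S →ₐ[k] Matrix (Fin l) (Fin l) k}

theorem IsFaithfulFamily.blockHom (hφ : IsFaithfulFamily φ) (m : ℕ) :
    IsFaithfulFamily fun ω => blockHom (φ ω) m where
  ext h := Prod.ext (hφ.ext fun ω => (blockHom_inj.1 (h ω)).1)
    (blockHom_inj.1 (h (Classical.arbitrary Ω))).2
  isUnit h := Prod.isUnit_iff.2 ⟨hφ.isUnit fun ω => (isUnit_blockHom.1 (h ω)).1,
    (isUnit_blockHom.1 (h (Classical.arbitrary Ω))).2⟩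

variable {Γ : SLP k} {τ : k} {n : ℕ} {a b r e : S}

theorem SLP.InvertsOn.exists_runIn_T₁_of_le (hΓ : Γ.InvertsOn τ (T₁ τ n)) (hln : l ≤ n)
    (hφ : IsFaithfulFamily φ) (hr : (a - b) * r = 1) (he : (a + τ • (b * r * b)) * e = 1) :
    ∃ t, RunIn Γ.code [a, b] t ∧ e ∈ t ∧ -(r * b * e) ∈ t := by
  obtain ⟨m, rfl⟩ := Nat.exists_eq_add_of_le hln
  obtain ⟨t, ht, h₁, h₂⟩ := hΓ.exists_runIn_T₁ (hφ.blockHom m)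
    (a := (a, 1)) (b := (b, 0)) (r := (r, 1)) (e := (e, 1))
    (Prod.ext hr (by simp)) (Prod.ext he (by simp))
  let π := AlgHom.fst k S (Matrix (Fin m) (Fin m) k)
  exact ⟨t.map π, ht.map π, List.mem_map_of_mem (f := π) h₁, List.mem_map_of_mem (f := π) h₂⟩

theorem SLP.InvertsOn.exists_runIn_T₂_of_le (hΓ : Γ.InvertsOn τ (T₂ τ n)) (hτ : τ ≠ 0)
    (hln : l ≤ n) (hφ : IsFaithfulFamily φ) (hr : b * r = 1)
    (he : (a * r * a - a + τ • b) * e = 1) :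
    ∃ t, RunIn Γ.code [a, b] t ∧ (r * a - 1) * e ∈ t ∧ -e ∈ t := by
  obtain ⟨m, rfl⟩ := Nat.exists_eq_add_of_le hln
  obtain ⟨t, ht, h₁, h₂⟩ := hΓ.exists_runIn_T₂ (hφ.blockHom m)
    (a := (a, 0)) (b := (b, 1)) (r := (r, 1)) (e := (e, τ⁻¹ • 1))
    (Prod.ext hr (by simp)) (Prod.ext he (by simp [hτ]))
  let π := AlgHom.fst k S (Matrix (Fin m) (Fin m) k)
  exact ⟨t.map π, ht.map π, List.mem_map_of_mem (f := π) h₁, List.mem_map_of_mem (f := π) h₂⟩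

end Block

section Reach

variable {k S : Type*} [Field k] [Ring S] [Algebra k S] {W₀ W : Submodule k S} {m : ℕ}

/-- `z` is the result of one multiplication or inversion applied to elements of `W`. -/
def IsProdOrInv (W : Submodule k S) (z : S) : Prop :=
  (∃ x ∈ W, ∃ y ∈ W, z = x * y) ∨ ∃ x ∈ W, x * z = 1 ∧ z * x = 1

theorem IsProdOrInv.mono {W' : Submodule k S} {z : S} (hz : IsProdOrInv W z) (h : W ≤ W') :
    IsProdOrInv W' z := by
  rcases hz with ⟨x, hx, y, hy, rfl⟩ | ⟨x, hx, hz⟩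
  · exact .inl ⟨x, h hx, y, h hy, rfl⟩
  · exact .inr ⟨x, h hx, hz⟩

/-- The submodule `W` arises from `W₀` by adjoining `m` times in a row the result of one
multiplication or inversion. Additions and scalar multiples are free, so the submodule spanned by
the registers records everything about a program that matters for its cost. -/
inductive Reach (W₀ : Submodule k S) : ℕ → Submodule k S → Prop
  | base : Reach W₀ 0 W₀
  | step {m : ℕ} {W : Submodule k S} {z : S} : Reach W₀ m W → IsProdOrInv W z →
      Reach W₀ (m + 1) (W ⊔ Submodule.span k {z})

theorem Reach.le (h : Reach W₀ m W) : W₀ ≤ W := by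
  induction h with
  | base => exact le_rfl
  | step _ _ ih => exact ih.trans le_sup_left

theorem Reach.exists_ge {m' : ℕ} (h : Reach W₀ m W) (hone : 1 ∈ W₀) (hm : m ≤ m') :
    ∃ W', Reach W₀ m' W' ∧ W ≤ W' := by
  induction m', hm using Nat.le_induction with
  | base => exact ⟨W, h, le_rfl⟩
  | succ m' _ ih =>
    obtain ⟨W', hW', hle⟩ := ih
    exact ⟨_, hW'.step (.inl ⟨1, hW'.le hone, 1, hW'.le hone, rfl⟩), hle.trans le_sup_left⟩

theorem mem_sup_span_singleton {g z : S} :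
    g ∈ W ⊔ Submodule.span k {z} ↔ ∃ w ∈ W, ∃ c : k, g = w + c • z := by
  simp only [Submodule.mem_sup, Submodule.mem_span_singleton, exists_exists_eq_and, @eq_comm _ g]

theorem ExecIn.isProdOrInv {s : List S} {op : Instr k} {z : S} (hz : ExecIn s op z)
    (hs : ∀ x ∈ s, x ∈ W) (hop : op.isInv ∨ op.isMul) : IsProdOrInv W z := by
  cases op with
  | mul i j =>
    obtain ⟨x, y, hx, hy, rfl⟩ := hz
    exact .inl ⟨x, hs x (List.mem_of_getElem? hx), y, hs y (List.mem_of_getElem? hy), rfl⟩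
  | inv i =>
    obtain ⟨x, hx, hxz⟩ := hz
    exact .inr ⟨x, hs x (List.mem_of_getElem? hx), hxz⟩
  | _ => simp [Instr.isInv, Instr.isMul] at hop

theorem ExecIn.mem {s : List S} {op : Instr k} {z : S} (hz : ExecIn s op z)
    (hone : 1 ∈ W) (hs : ∀ x ∈ s, x ∈ W) (hinv : ¬op.isInv) (hmul : ¬op.isMul) : z ∈ W := by
  cases op with
  | const c =>
    obtain rfl : z = c • 1 := hz
    exact W.smul_mem c hone
  | smul c i =>
    obtain ⟨x, hx, rfl⟩ := hz
    exact W.smul_mem c (hs x (List.mem_of_getElem? hx))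
  | add i j =>
    obtain ⟨x, y, hx, hy, rfl⟩ := hz
    exact W.add_mem (hs x (List.mem_of_getElem? hx)) (hs y (List.mem_of_getElem? hy))
  | mul i j => exact absurd rfl hmul
  | inv i => exact absurd rfl hinv

theorem RunIn.exists_reach {code : List (Instr k)} {s t : List S} (h : RunIn code s t)
    (hW : Reach W₀ m W) (hone : 1 ∈ W₀) (hs : ∀ x ∈ s, x ∈ W) :
    ∃ W', Reach W₀ (m + (code.countP Instr.isInv + code.countP Instr.isMul)) W' ∧
      ∀ x ∈ t, x ∈ W' := by
  induction h generalizing W m with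
  | nil s => exact ⟨W, hW, hs⟩
  | @cons op ops s t z hz _ ih =>
    have happend {W' : Submodule k S} (hle : W ≤ W') (hzW : z ∈ W') : ∀ x ∈ s ++ [z], x ∈ W' := by
      simpa [or_imp, forall_and] using And.intro (fun x hx => hle (hs x hx)) hzW
    by_cases hop : op.isInv ∨ op.isMul
    · obtain ⟨W', hW', ht⟩ := ih (hW.step (hz.isProdOrInv hs hop)) (happend le_sup_left
        (Submodule.mem_sup_right (Submodule.mem_span_singleton_self z)))
      refine ⟨W', ?_, ht⟩
      convert hW' using 1
      cases op <;> simp [List.countP_cons, Instr.isInv, Instr.isMul] at hop ⊢ <;> omega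
    · obtain ⟨hinv, hmul⟩ := not_or.1 hop
      simpa [List.countP_cons, hinv, hmul] using
        ih hW (happend le_rfl (hz.mem (hW.le hone) hs hinv hmul))

theorem RunIn.exists_reach_cost {Γ : SLP k} {a b : S} {t : List S}
    (ht : RunIn Γ.code [a, b] t) :
    ∃ W, Reach (Submodule.span k {1, a, b}) Γ.cost W ∧ ∀ x ∈ t, x ∈ W := by
  have hreg : ∀ x ∈ [a, b], x ∈ Submodule.span k {1, a, b} := fun x hx =>
    Submodule.subset_span (by simpa using Or.inr (by simpa using hx))
  simpa [SLP.cost, SLP.numInv, SLP.numMul] using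
    ht.exists_reach .base (Submodule.subset_span (by simp)) hreg

-- The last step enlarges the submodule by one dimension, so it cannot be responsible for all
-- combinations of two given elements.
theorem Reach.exists_smul_add_smul_mem {m' : ℕ} (h : Reach W₀ m' W) (hone : 1 ∈ W₀)
    (hm : m' ≤ m + 1) {c d : S} (hc : c ∈ W) (hd : d ∈ W) :
    ∃ (W' : Submodule k S) (α β : k), Reach W₀ m W' ∧ (α ≠ 0 ∨ β ≠ 0) ∧ α • c + β • d ∈ W' := by
  obtain ⟨_, hW₁, hle⟩ := h.exists_ge hone hm
  cases hW₁ with | @step _ W' z hW' _ =>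
  obtain ⟨w, hw, p, rfl⟩ := mem_sup_span_singleton.1 (hle hc)
  obtain ⟨w', hw', q, rfl⟩ := mem_sup_span_singleton.1 (hle hd)
  by_cases hp : p = 0
  · exact ⟨W', 1, 0, hW', .inl one_ne_zero, by simpa [hp] using hw⟩
  · refine ⟨W', -q, p, hW', .inr hp, ?_⟩
    have hcancel : -q • (w + p • z) + p • (w' + q • z) = -q • w + p • w' := by module
    rw [hcancel]
    exact W'.add_mem (W'.smul_mem _ hw) (W'.smul_mem _ hw')

end Reach

section Monomial

variable {k S S' : Type*} [Field k] [Ring S] [Algebra k S] [Ring S'] [Algebra k S'] {G : Set S}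

/-- The elements obtained from scalars and elements of `G` by multiplications and inversions,
that is, what a program without additions computes from registers in `G`. -/
inductive Monomial (k : Type*) {S : Type*} [Field k] [Ring S] [Algebra k S] (G : Set S) :
    S → Prop
  | const (c : k) : Monomial k G (c • 1)
  | of {x : S} : x ∈ G → Monomial k G x
  | mul {x y : S} : Monomial k G x → Monomial k G y → Monomial k G (x * y)
  | inv {x y : S} : Monomial k G x → x * y = 1 → y * x = 1 → Monomial k G y

theorem Monomial.mono {G' : Set S} (h : G ⊆ G') {x : S} (hx : Monomial k G x) :
    Monomial k G' x := by
  induction hx with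
  | const c => exact .const c
  | of hx => exact .of (h hx)
  | mul _ _ ihx ihy => exact ihx.mul ihy
  | inv _ h₁ h₂ ih => exact ih.inv h₁ h₂

theorem Monomial.one : Monomial k G 1 := by
  simpa using Monomial.const (G := G) (1 : k)

theorem ExecIn.monomial {s : List S} {op : Instr k} {z : S} (hz : ExecIn s op z)
    (hop : ¬op.isAdd) (hs : ∀ x ∈ s, Monomial k G x) : Monomial k G z := by
  cases op with
  | const c =>
    obtain rfl : z = c • 1 := hz
    exact .const c
  | smul c i =>
    obtain ⟨x, hx, rfl⟩ := hz
    simpa using (Monomial.const c).mul (hs x (List.mem_of_getElem? hx))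
  | add i j => exact absurd rfl hop
  | mul i j =>
    obtain ⟨x, y, hx, hy, rfl⟩ := hz
    exact (hs x (List.mem_of_getElem? hx)).mul (hs y (List.mem_of_getElem? hy))
  | inv i =>
    obtain ⟨x, hx, h₁, h₂⟩ := hz
    exact (hs x (List.mem_of_getElem? hx)).inv h₁ h₂

theorem RunIn.monomial {code : List (Instr k)} {s t : List S} (h : RunIn code s t)
    (hcode : code.countP Instr.isAdd = 0) (hs : ∀ x ∈ s, Monomial k G x) :
    ∀ x ∈ t, Monomial k G x := by
  induction h with
  | nil s => exact hs
  | @cons op ops s t z hz _ ih =>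
    obtain ⟨hop, hops⟩ : ¬op.isAdd ∧ ops.countP Instr.isAdd = 0 := by
      simpa [List.countP_cons, and_comm] using hcode
    refine ih hops ?_
    simpa [or_imp, forall_and] using And.intro hs (hz.monomial hop hs)

theorem RunIn.exists_monomial_insert_add {code : List (Instr k)} {s t : List S}
    (h : RunIn code s t) (hcode : code.countP Instr.isAdd ≤ 1) (hs : ∀ x ∈ s, Monomial k G x) :
    ∃ x y, Monomial k G x ∧ Monomial k G y ∧ ∀ z ∈ t, Monomial k (insert (x + y) G) z := by
  induction h with
  | nil s =>
    exact ⟨(0 : k) • 1, (0 : k) • 1, .const 0, .const 0,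
      fun z hz => (hs z hz).mono (Set.subset_insert _ _)⟩
  | @cons op ops s t z hz hops ih =>
    by_cases hop : op.isAdd
    · obtain ⟨i, j, rfl⟩ : ∃ i j, op = .add i j := by cases op <;> simp [Instr.isAdd] at hop ⊢
      obtain ⟨x, y, hx, hy, rfl⟩ := hz
      refine ⟨x, y, hs x (List.mem_of_getElem? hx), hs y (List.mem_of_getElem? hy),
        hops.monomial (by simpa [List.countP_cons, hop] using hcode) ?_⟩
      simpa [or_imp, forall_and] using And.intro
        (fun w hw => (hs w hw).mono (Set.subset_insert (x + y) G)) (.of (Set.mem_insert _ _))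
    · refine ih (by simpa [List.countP_cons, hop] using hcode) ?_
      simpa [or_imp, forall_and] using And.intro hs (hz.monomial hop hs)

/-- `x` lies in the image of the structure map `k → S`. -/
def IsScalar (k : Type*) {S : Type*} [Field k] [Ring S] [Algebra k S] (x : S) : Prop :=
  ∃ c : k, x = c • 1

theorem Monomial.eq_smul_zpow_or_not_isUnit [IsDedekindFiniteMonoid S] (u : Sˣ)
    (hG : ∀ g ∈ G, ¬IsUnit g) {x : S} (hx : Monomial k (insert (u : S) G) x) :
    (∃ (c : k) (z : ℤ), x = c • ((u ^ z : Sˣ) : S)) ∨ ¬IsUnit x := by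
  induction hx with
  | const c => exact .inl ⟨c, 0, by simp⟩
  | of hx =>
    rcases hx with rfl | hx
    · exact .inl ⟨1, 1, by simp⟩
    · exact .inr (hG _ hx)
  | mul _ _ ihx ihy =>
    rw [IsUnit.mul_iff, not_and_or]
    rcases ihx with ⟨c, z, rfl⟩ | hx
    · rcases ihy with ⟨c', z', rfl⟩ | hy
      · exact .inl ⟨c * c', z + z', by rw [smul_mul_smul_comm, zpow_add, Units.val_mul]⟩
      · exact .inr (.inr hy)
    · exact .inr (.inl hx)
  | @inv x y _ hxy _ ih =>
    rcases ih with ⟨c, z, rfl⟩ | hx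
    · have hy : c • y = ((u ^ (-z) : Sˣ) : S) := by
        rw [zpow_neg, ← (u ^ z).mul_right_inj, Units.mul_inv, mul_smul_comm, ← smul_mul_assoc, hxy]
      obtain rfl | hc := eq_or_ne c 0
      · exact .inl ⟨0, 0, by simpa using congrArg (y * ·) hxy.symm⟩
      · exact .inl ⟨c⁻¹, -z, by rw [← hy, smul_smul, inv_mul_cancel₀ hc, one_smul]⟩
    · exact absurd (.of_mul_eq_one _ hxy) hx

theorem Monomial.isScalar_or_not_isUnit [IsDedekindFiniteMonoid S] (hG : ∀ g ∈ G, ¬IsUnit g)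
    {x : S} (hx : Monomial k G x) : IsScalar k x ∨ ¬IsUnit x :=
  (Monomial.eq_smul_zpow_or_not_isUnit 1 hG (hx.mono (Set.subset_insert _ _))).imp_left
    fun ⟨c, z, h⟩ => ⟨c, by simpa using h⟩

theorem Monomial.isUnit_of_insert [IsDedekindFiniteMonoid S] (hG : ∀ g ∈ G, ¬IsUnit g) {s x : S}
    (hx : Monomial k (insert s G) x) (hunit : IsUnit x) (hscalar : ¬IsScalar k x) : IsUnit s := by
  by_contra hs
  have hG' : ∀ g ∈ insert s G, ¬IsUnit g := by simpa [hs] using hG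
  exact hx.isScalar_or_not_isUnit hG' |>.elim hscalar (absurd hunit)

theorem Monomial.isUnit_or_map_eq_zero (φ : S →ₐ[k] S')
    (hG : ∀ g ∈ G, IsUnit g ∨ φ g = 0) {x : S} (hx : Monomial k G x) : IsUnit x ∨ φ x = 0 := by
  induction hx with
  | const c =>
    obtain rfl | hc := eq_or_ne c 0
    · exact .inr (by simp)
    · rw [← Algebra.algebraMap_eq_smul_one]
      exact .inl ((IsUnit.mk0 c hc).map (algebraMap k S))
  | of hx => exact hG _ hx
  | mul _ _ ihx ihy =>
    rcases ihx with hx | hx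
    · rcases ihy with hy | hy
      · exact .inl (hx.mul hy)
      · exact .inr (by rw [map_mul, hy, mul_zero])
    · exact .inr (by rw [map_mul, hx, zero_mul])
  | inv _ h₁ h₂ _ => exact .inl ⟨⟨_, _, h₂, h₁⟩, rfl⟩

end Monomial

section AdditionsT₂

variable {k : Type*} [Field k] {τ : k} {n : ℕ}

theorem isFaithfulFamily_eval (k Ω : Type*) [Field k] (n : ℕ) :
    IsFaithfulFamily (Pi.evalAlgHom k fun _ : Ω => Matrix (Fin n) (Fin n) k) where
  ext := funext
  isUnit := Pi.isUnit_iff.2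

/-- The nilpotent matrix unit `E₁₂`. -/
def nilMatrix (k : Type*) [Field k] : Matrix (Fin 2) (Fin 2) k := !![0, 1; 0, 0]

theorem nilMatrix_mul_self : nilMatrix k * nilMatrix k = 0 := by
  ext i j
  fin_cases i <;> fin_cases j <;> simp [nilMatrix]

theorem nilMatrix_ne_zero : nilMatrix k ≠ 0 := fun h => by
  simpa [nilMatrix] using congrFun₂ h 0 1

theorem sub_add_smul_one_mul_of_mul_self_eq_zero {S : Type*} [Ring S] [Algebra k S] {v : S}
    (hτ : τ ≠ 0) (hv : v * v = 0) :
    (v * 1 * v - v + τ • 1) * (τ⁻¹ • 1 + (τ⁻¹ * τ⁻¹) • v) = 1 := by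
  have hcancel : (τ⁻¹ * τ⁻¹) • τ • v = τ⁻¹ • v := by rw [smul_smul, inv_mul_cancel_right₀ hτ]
  simp [hτ, hv, hcancel, add_mul, mul_add]

-- At `B = 1` the inverse of `X₃` is invertible and not scalar, so the only sum is invertible and
-- every result is invertible or vanishes at `A = 0`. But `(A - 1) X₄` vanishes at `A = 1` and not
-- at `A = 0`.
theorem two_le_numAdd_T₂ {Γ : SLP k} (hΓ : Γ.InvertsOn τ (T₂ τ n)) (hτ : τ ≠ 0) (hn : 2 ≤ n) :
    2 ≤ Γ.numAdd := by
  by_contra hlt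
  set v := nilMatrix k
  let a : Fin 3 → Matrix (Fin 2) (Fin 2) k := ![0, 1, v]
  let e : Fin 3 → Matrix (Fin 2) (Fin 2) k := ![τ⁻¹ • 1, τ⁻¹ • 1, τ⁻¹ • 1 + (τ⁻¹ * τ⁻¹) • v]
  have he : (a * 1 * a - a + τ • 1) * e = 1 := by
    funext ω
    fin_cases ω
    · change (0 * 1 * 0 - 0 + τ • 1) * τ⁻¹ • 1 = (1 : Matrix (Fin 2) (Fin 2) k)
      simp [hτ]
    · change (1 * 1 * 1 - 1 + τ • 1) * τ⁻¹ • 1 = (1 : Matrix (Fin 2) (Fin 2) k)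
      simp [hτ]
    · exact sub_add_smul_one_mul_of_mul_self_eq_zero hτ nilMatrix_mul_self
  obtain ⟨t, ht, hCt, het⟩ := hΓ.exists_runIn_T₂_of_le hτ hn (isFaithfulFamily_eval k (Fin 3) 2)
    (one_mul 1) he
  obtain ⟨x, y, -, -, hmon⟩ := ht.exists_monomial_insert_add (G := {a})
    (Nat.lt_succ_iff.1 (not_le.1 hlt))
    (by simpa using ⟨Monomial.of (Set.mem_singleton a), Monomial.one⟩)
  have ha : ∀ g ∈ ({a} : Set (Fin 3 → Matrix (Fin 2) (Fin 2) k)), ¬IsUnit g := by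
    rintro _ rfl h
    simpa [a] using Pi.isUnit_iff.1 h 0
  have hunit : IsUnit (x + y) := by
    refine (hmon _ het).isUnit_of_insert ha (IsUnit.of_mul_eq_one_right _ he).neg ?_
    rintro ⟨c, hc⟩
    have h01 := congrFun₂ (congrFun hc 2) 0 1
    simp [e, v, nilMatrix, hτ] at h01
  rcases (hmon _ hCt).isUnit_or_map_eq_zero
    (Pi.evalAlgHom k (fun _ : Fin 3 => Matrix (Fin 2) (Fin 2) k) 0)
    (by simp [hunit, a]) with hC | hC
  · have h₁ : IsUnit ((1 * 1 - 1) * τ⁻¹ • (1 : Matrix (Fin 2) (Fin 2) k)) := Pi.isUnit_iff.1 hC 1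
    simp at h₁
  · change (1 * 0 - 1) * τ⁻¹ • (1 : Matrix (Fin 2) (Fin 2) k) = 0 at hC
    simp [hτ] at hC

end AdditionsT₂

section AdditionsT₁

theorem Monomial.exists_smul_mem_closure {k S : Type*} [Field k] [Ring S] [Algebra k S]
    [IsDedekindFiniteMonoid S] {G : Set S} (hG : ∀ g ∈ G, ¬IsUnit g) {x : S}
    (hx : Monomial k G x) : ∃ α : k, ∃ w ∈ Submonoid.closure G, x = α • w := by
  induction hx with
  | const c => exact ⟨c, 1, one_mem _, rfl⟩
  | of hx => exact ⟨1, _, Submonoid.subset_closure hx, (one_smul k _).symm⟩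
  | mul _ _ ihx ihy =>
    obtain ⟨α, w, hw, rfl⟩ := ihx
    obtain ⟨β, w', hw', rfl⟩ := ihy
    exact ⟨α * β, w * w', mul_mem hw hw', smul_mul_smul_comm α w β w'⟩
  | inv hx h₁ h₂ _ =>
    obtain ⟨c, hc⟩ := (hx.inv h₁ h₂).isScalar_or_not_isUnit hG |>.resolve_right
      (not_not.2 (.of_mul_eq_one _ h₂))
    exact ⟨c, 1, one_mem _, hc⟩

theorem eq_pow_or_eq_pow_or_of_mem_closure_pair {M : Type*} [Monoid M] {a b w : M}
    (hw : w ∈ Submonoid.closure {a, b}) :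
    (∃ i, w = a ^ i) ∨ (∃ j, w = b ^ j) ∨ ∃ p q, w = p * (a * b) * q ∨ w = p * (b * a) * q := by
  induction hw using Submonoid.closure_induction_left with
  | one => exact .inl ⟨0, (pow_zero a).symm⟩
  | mul_left x hx y _ ih =>
    rcases ih with ⟨i, rfl⟩ | ⟨j, rfl⟩ | ⟨p, q, hy⟩
    · rcases hx with rfl | rfl
      · exact .inl ⟨i + 1, (pow_succ' _ _).symm⟩
      · cases i with
        | zero => exact .inr (.inl ⟨1, by simp⟩)
        | succ i =>
          exact .inr (.inr ⟨1, a ^ i, .inr (by simp only [pow_succ', one_mul, mul_assoc])⟩)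
    · rcases hx with rfl | rfl
      · cases j with
        | zero => exact .inl ⟨1, by simp⟩
        | succ j =>
          exact .inr (.inr ⟨1, b ^ j, .inl (by simp only [pow_succ', one_mul, mul_assoc])⟩)
      · exact .inr (.inl ⟨j + 1, (pow_succ' _ _).symm⟩)
    · refine .inr (.inr ⟨x * p, q, hy.imp ?_ ?_⟩) <;> rintro rfl <;> simp only [mul_assoc]

section Homs

variable {k S S' : Type*} [Field k] [Ring S] [Algebra k S] [Ring S'] [Algebra k S']
  [IsDedekindFiniteMonoid S] {a b x y : S} {φ φ' ψ ψ' : S →ₐ[k] S'}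

theorem Monomial.eq_smul_pow_or_map_eq (ha : ¬IsUnit a) (hb : ¬IsUnit b)
    (hφ : φ b = 0) (hφ' : φ' b = 0) (hψ : ψ a = 0) (hψ' : ψ' a = 0)
    (hx : Monomial k {a, b} x) :
    (∃ α : k, ∃ i ≠ 0, x = α • a ^ i) ∨ (∃ β : k, ∃ j ≠ 0, x = β • b ^ j) ∨
      φ x = φ' x ∧ ψ x = ψ' x := by
  obtain ⟨α, w, hw, rfl⟩ := hx.exists_smul_mem_closure (by simp [ha, hb])
  rcases eq_pow_or_eq_pow_or_of_mem_closure_pair hw with ⟨i, rfl⟩ | ⟨j, rfl⟩ | ⟨p, q, rfl | rfl⟩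
  · obtain rfl | hi := eq_or_ne i 0
    · exact .inr (.inr (by simp))
    · exact .inl ⟨α, i, hi, rfl⟩
  · obtain rfl | hj := eq_or_ne j 0
    · exact .inr (.inr (by simp))
    · exact .inr (.inl ⟨α, j, hj, rfl⟩)
  all_goals exact .inr (.inr (by simp [hφ, hφ', hψ, hψ']))

theorem Monomial.exists_add_eq_smul_pow_add_smul_pow (ha : ¬IsUnit a) (hb : ¬IsUnit b)
    (hφ : φ b = 0) (hφ' : φ' b = 0) (hψ : ψ a = 0) (hψ' : ψ' a = 0)
    (hx : Monomial k {a, b} x) (hy : Monomial k {a, b} y)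
    (hφne : φ (x + y) ≠ φ' (x + y)) (hψne : ψ (x + y) ≠ ψ' (x + y)) :
    ∃ (α β : k) (i j : ℕ), i ≠ 0 ∧ j ≠ 0 ∧ x + y = α • a ^ i + β • b ^ j := by
  rw [map_add, map_add] at hφne hψne
  rcases hx.eq_smul_pow_or_map_eq ha hb hφ hφ' hψ hψ' with
    ⟨α, i, hi, rfl⟩ | ⟨β, j, hj, rfl⟩ | ⟨hφx, hψx⟩ <;>
  rcases hy.eq_smul_pow_or_map_eq ha hb hφ hφ' hψ hψ' with
    ⟨α', i', hi', rfl⟩ | ⟨β', j', hj', rfl⟩ | ⟨hφy, hψy⟩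
  · exact absurd (by simp [hψ, hψ', hi, hi']) hψne
  · exact ⟨α, β', i, j', hi, hj', rfl⟩
  · exact absurd (by simp [hψ, hψ', hi, hψy]) hψne
  · exact ⟨α', β, i', j, hi', hj, add_comm _ _⟩
  · exact absurd (by simp [hφ, hφ', hj, hj']) hφne
  · exact absurd (by simp [hφ, hφ', hj, hφy]) hφne
  · exact absurd (by simp [hψ, hψ', hi', hψx]) hψne
  · exact absurd (by simp [hφ, hφ', hj', hφx]) hφne
  · exact absurd (by rw [hφx, hφy]) hφne

end Homs

section Nilpotent

variable {k S : Type*} [Field k] [Ring S] [Algebra k S] {v w : S} {α β : k}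

theorem eq_one_of_isUnit_smul_pow_add_smul_pow [Nontrivial S] (hv : v * v = 0) (hw : w * w = 0)
    {i j : ℕ} (hi : i ≠ 0) (hj : j ≠ 0) (h : IsUnit (α • v ^ i + β • w ^ j)) : i = 1 := by
  by_contra hi1
  have hvi : v ^ i = 0 := pow_eq_zero_of_le (by omega : 2 ≤ i) (by rw [sq, hv])
  have hwj : IsNilpotent (β • w ^ j) :=
    (IsNilpotent.pow_of_pos ⟨2, by rw [sq, hw]⟩ hj).smul β
  exact (by simpa [hvi] using h : IsUnit (β • w ^ j)).not_isNilpotent hwj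

theorem val_zpow_of_val_eq_smul (hv : v * v = 0) (hα : α ≠ 0) {s : k} {u : Sˣ}
    (hu : (u : S) = α • (1 + s • v)) (z : ℤ) :
    ((u ^ z : Sˣ) : S) = α ^ z • (1 + (z * s) • v) := by
  have hmul (s t : k) : (1 + s • v) * (1 + t • v) = 1 + (s + t) • v := by
    simp only [mul_add, add_mul, smul_mul_smul_comm, hv, smul_zero, one_mul, mul_one, add_smul]
    abel
  have hinv : ((u⁻¹ : Sˣ) : S) = α⁻¹ • (1 + (-s) • v) := by
    apply Units.inv_eq_of_mul_eq_one_right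
    rw [hu, smul_mul_smul_comm, hmul, mul_inv_cancel₀ hα]
    simp
  induction z using Int.induction_on with
  | zero => simp
  | succ z ih =>
    rw [zpow_add_one, Units.val_mul, ih, hu, smul_mul_smul_comm, hmul, ← zpow_add_one₀ hα]
    push_cast
    ring_nf
  | pred z ih =>
    rw [zpow_sub_one, Units.val_mul, ih, hinv, smul_mul_smul_comm, hmul, ← zpow_sub_one₀ hα]
    push_cast
    ring_nf

end Nilpotent

variable {k : Type*} [Field k] {τ : k} {n : ℕ}

/-- The inputs `A` at which programs for `T₁` with at most one addition fail. -/
def sampleA (k : Type*) [Field k] : Fin 6 → Matrix (Fin 2) (Fin 2) k :=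
  ![1, 1 + nilMatrix k, 0, 0, nilMatrix k, 1]

/-- The inputs `B` that go with `sampleA`. -/
def sampleB (k : Type*) [Field k] : Fin 6 → Matrix (Fin 2) (Fin 2) k :=
  ![0, 0, 1, 1 + nilMatrix k, (nilMatrix k).transpose, nilMatrix k]

/-- The value `X₄` of the first branch at the inputs `sampleA` and `sampleB`. -/
def sampleX₄ (τ : k) : Fin 6 → Matrix (Fin 2) (Fin 2) k :=
  ![1, 1 - nilMatrix k, -τ⁻¹ • 1, -τ⁻¹ • (1 - nilMatrix k), !![0, -τ⁻¹; 1, 0], 1]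

theorem exists_sampleX₄ (hτ : τ ≠ 0) : ∃ r, (sampleA k - sampleB k) * r = 1 ∧
    (sampleA k + τ • (sampleB k * r * sampleB k)) * sampleX₄ τ = 1 := by
  refine ⟨![1, 1 - nilMatrix k, -1, -(1 - nilMatrix k), !![0, -1; 1, 0], 1 + nilMatrix k],
    ?_, ?_⟩ <;>
  funext ω <;>
  simp only [Pi.mul_apply, Pi.sub_apply, Pi.add_apply, Pi.smul_apply, Pi.one_apply] <;>
  fin_cases ω <;> ext i j <;> fin_cases i <;> fin_cases j <;>
  simp [sampleA, sampleB, sampleX₄, nilMatrix, Matrix.mul_apply, Matrix.vecMul, dotProduct,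
    Fin.sum_univ_two, hτ]

theorem not_isUnit_sampleA : ¬IsUnit (sampleA k) := fun h => by
  simpa [sampleA] using Pi.isUnit_iff.1 h 2

theorem not_isUnit_sampleB : ¬IsUnit (sampleB k) := fun h => by
  simpa [sampleB] using Pi.isUnit_iff.1 h 0

theorem sampleX₄_ne : sampleX₄ τ 0 ≠ sampleX₄ τ 1 := fun h => by
  simpa [sampleX₄, nilMatrix_ne_zero] using sub_eq_self.1 h.symm

theorem sampleX₄_ne' (hτ : τ ≠ 0) : sampleX₄ τ 2 ≠ sampleX₄ τ 3 := fun h => by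
  simp [sampleX₄, hτ, smul_sub, nilMatrix_ne_zero] at h

theorem val_zpow_apply {Ω M : Type*} [Monoid M] (u : (Ω → M)ˣ) (z : ℤ) (i : Ω) :
    (u ^ z : (Ω → M)ˣ).val i = (MulEquiv.piUnits u i ^ z : Mˣ).val := by
  rw [← Pi.pow_apply, ← map_zpow]
  rfl

theorem exists_eq_smul_sampleA_add_smul_sampleB (hτ : τ ≠ 0)
    {x y : Fin 6 → Matrix (Fin 2) (Fin 2) k} (hx : Monomial k {sampleA k, sampleB k} x)
    (hy : Monomial k {sampleA k, sampleB k} y) {u : (Fin 6 → Matrix (Fin 2) (Fin 2) k)ˣ}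
    (hu : u = x + y) {c : k} {z : ℤ}
    (he : sampleX₄ τ = c • (u ^ z : (Fin 6 → Matrix (Fin 2) (Fin 2) k)ˣ).val) :
    ∃ α β : k, u = α • sampleA k + β • sampleB k := by
  let ev := Pi.evalAlgHom k fun _ : Fin 6 => Matrix (Fin 2) (Fin 2) k
  have hne {i j : Fin 6} (h : sampleX₄ τ i ≠ sampleX₄ τ j) : ev i (x + y) ≠ ev j (x + y) := by
    intro hij
    have hunits : MulEquiv.piUnits u i = MulEquiv.piUnits u j := Units.ext <| by
      simpa [ev, ← hu] using hij
    exact h (by rw [he, Pi.smul_apply, Pi.smul_apply, val_zpow_apply, val_zpow_apply, hunits])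
  obtain ⟨α, β, i, j, hi, hj, hxy⟩ := Monomial.exists_add_eq_smul_pow_add_smul_pow
    (φ := ev 0) (φ' := ev 1) (ψ := ev 2) (ψ' := ev 3)
    not_isUnit_sampleA not_isUnit_sampleB rfl rfl rfl rfl hx hy (hne sampleX₄_ne)
    (hne (sampleX₄_ne' hτ))
  have hunit : IsUnit (α • nilMatrix k ^ i + β • (nilMatrix k).transpose ^ j) :=
    Pi.isUnit_iff.1 (hxy ▸ hu ▸ u.isUnit) 4
  have hnil : (nilMatrix k).transpose * (nilMatrix k).transpose = 0 := by
    rw [← Matrix.transpose_mul, nilMatrix_mul_self, Matrix.transpose_zero]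
  obtain rfl := eq_one_of_isUnit_smul_pow_add_smul_pow nilMatrix_mul_self hnil hi hj hunit
  obtain rfl := eq_one_of_isUnit_smul_pow_add_smul_pow hnil nilMatrix_mul_self hj one_ne_zero
    (add_comm _ (_ : Matrix (Fin 2) (Fin 2) k) ▸ hunit)
  exact ⟨α, β, by simpa [hu] using hxy⟩

theorem sampleX₄_ne_smul_zpow {u : (Fin 6 → Matrix (Fin 2) (Fin 2) k)ˣ} {α β : k}
    (hu : u = α • sampleA k + β • sampleB k) (c : k) (z : ℤ) :
    sampleX₄ τ ≠ c • (u ^ z : (Fin 6 → Matrix (Fin 2) (Fin 2) k)ˣ).val := by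
  intro he
  set v := nilMatrix k
  have hα : α ≠ 0 := by
    rintro rfl
    simpa [hu, sampleB] using Pi.isUnit_iff.1 u.isUnit 0
  have hpoint (i : Fin 6) (s : k) (hi : u.val i = α • (1 + s • v)) :
      sampleX₄ τ i = c • α ^ z • (1 + (z * s) • v) := by
    rw [he, Pi.smul_apply, val_zpow_apply, val_zpow_of_val_eq_smul nilMatrix_mul_self hα hi]
  have h₀ := hpoint 0 0 (by simp [hu, sampleA, sampleB])
  have h₁ := hpoint 1 1 (by simp [hu, sampleA, sampleB, v])
  have h₅ := hpoint 5 (α⁻¹ * β) (by simp [hu, sampleA, sampleB, v, smul_smul, hα])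
  have hc : c * α ^ z = 1 := by simpa [sampleX₄, smul_smul] using congrFun₂ h₀.symm 0 0
  rw [smul_smul, hc, one_smul] at h₁ h₅
  have hz : (z : k) = -1 := by simpa [sampleX₄, v, nilMatrix] using congrFun₂ h₁.symm 0 1
  have hβ : β = 0 := by
    have hsmul : ((z : k) * (α⁻¹ * β)) • v = 0 := add_eq_left.1 h₅.symm
    simpa [hz, hα, v, nilMatrix_ne_zero] using hsmul
  simpa [hu, hβ, sampleA] using Pi.isUnit_iff.1 u.isUnit 2

theorem two_le_numAdd_T₁ {Γ : SLP k} (hΓ : Γ.InvertsOn τ (T₁ τ n)) (hτ : τ ≠ 0) (hn : 2 ≤ n) :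
    2 ≤ Γ.numAdd := by
  by_contra hlt
  obtain ⟨r, hr, he⟩ := exists_sampleX₄ hτ
  obtain ⟨t, ht, het, -⟩ := hΓ.exists_runIn_T₁_of_le hn (isFaithfulFamily_eval k (Fin 6) 2) hr he
  have hinput : ∀ x ∈ [sampleA k, sampleB k], Monomial k {sampleA k, sampleB k} x :=
    fun x hx => .of (by simpa using hx)
  have hG : ∀ g ∈ ({sampleA k, sampleB k} : Set _), ¬IsUnit g := by
    simp [not_isUnit_sampleA, not_isUnit_sampleB]
  have hX₄unit : IsUnit (sampleX₄ τ) := .of_mul_eq_one_right _ he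
  obtain ⟨x, y, hx, hy, hmon⟩ := ht.exists_monomial_insert_add
    (Nat.lt_succ_iff.1 (not_le.1 hlt)) hinput
  obtain ⟨u, hu⟩ : IsUnit (x + y) := by
    refine (hmon _ het).isUnit_of_insert hG hX₄unit ?_
    rintro ⟨c, hc⟩
    exact sampleX₄_ne (by rw [hc]; rfl)
  obtain ⟨c, z, hcz⟩ := Monomial.eq_smul_zpow_or_not_isUnit u hG (hu ▸ hmon _ het) |>.resolve_right
    (not_not.2 hX₄unit)
  obtain ⟨α, β, huαβ⟩ := exists_eq_smul_sampleA_add_smul_sampleB hτ hx hy hu hcz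
  exact sampleX₄_ne_smul_zpow huαβ c z hcz

end AdditionsT₁

section FieldPoints

open Polynomial

variable {k : Type*} [Field k] {K : Type*} [Field K] [Algebra k K] {τ : k} {θ : K} {d d' : ℕ}

/-- The parameters `(v, x)` of the commuting inputs `A = v x`, `B = x` in `K`. The two conditions
say that `B` and `A B⁻¹ A - A + τ B = (v² - v + τ) x` are invertible. -/
abbrev FieldPoint (τ : k) (K : Type*) [Field K] [Algebra k K] : Type _ :=
  {p : K × K // p.1 * p.1 - p.1 + algebraMap k K τ ≠ 0 ∧ p.2 ≠ 0}

/-- The polynomial `v² - v + τ` in the parameter `v`. -/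
def normPoly (τ : k) (K : Type*) [Field K] [Algebra k K] : K[X] :=
  X * X - X + C (algebraMap k K τ)

theorem eval_normPoly (v : K) : (normPoly τ K).eval v = v * v - v + algebraMap k K τ := by
  simp [normPoly]

theorem natDegree_normPoly : (normPoly τ K).natDegree = 2 := by
  unfold normPoly
  compute_degree!

/-- The root `θ` of `v² - v + τ` is linearly independent of `1` over `k`, and `K` has enough
elements for all polynomial identities that occur to be checked pointwise. -/
structure QuadRoot (τ : k) (K : Type*) [Field K] [Algebra k K] (θ : K) : Prop where
  root : θ * θ - θ + algebraMap k K τ = 0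
  indep : ∀ α β : k, algebraMap k K α * θ + algebraMap k K β = 0 → α = 0 ∧ β = 0
  card : ∃ s : Finset K, 16 ≤ s.card

theorem QuadRoot.eval_normPoly_eq_zero (hθ : QuadRoot τ K θ) : (normPoly τ K).eval θ = 0 := by
  rw [eval_normPoly, hθ.root]

theorem QuadRoot.eq_zero_of_eval_eq_zero (hθ : QuadRoot τ K θ) {P D : K[X]} (hD : D ≠ 0)
    (hdeg : P.natDegree + D.natDegree ≤ 15) (h : ∀ v : K, D.eval v ≠ 0 → P.eval v = 0) :
    P = 0 := by
  obtain ⟨s, hs⟩ := hθ.card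
  have hPD : P * D = 0 := by
    refine eq_zero_of_natDegree_lt_card_of_eval_eq_zero' _ s (fun v _ => ?_)
      (natDegree_mul_le.trans_lt (by omega))
    rw [eval_mul, mul_eq_zero, or_iff_not_imp_right]
    exact h v
  exact (mul_eq_zero.1 hPD).resolve_right hD

theorem QuadRoot.eq_zero_of_eval_eq_zero_of_ne_zero (hθ : QuadRoot τ K θ) {P : K[X]}
    (hdeg : P.natDegree ≤ 14) (h : ∀ x : K, x ≠ 0 → P.eval x = 0) : P = 0 :=
  hθ.eq_zero_of_eval_eq_zero X_ne_zero (by rw [natDegree_X]; omega) (by simpa using h)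

theorem QuadRoot.coeff_eq_zero (hθ : QuadRoot τ K θ) {s₀ s₁ s₂ s₃ s₄ : K}
    (h : ∀ x : K, x ≠ 0 → s₀ + s₁ * x + s₂ * x ^ 2 + s₃ * x ^ 3 + s₄ * x ^ 4 = 0) :
    s₀ = 0 ∧ s₁ = 0 ∧ s₂ = 0 ∧ s₃ = 0 ∧ s₄ = 0 := by
  have hP : C s₀ + C s₁ * X + C s₂ * X ^ 2 + C s₃ * X ^ 3 + C s₄ * X ^ 4 = 0 := by
    refine hθ.eq_zero_of_eval_eq_zero_of_ne_zero ?_ fun x hx => by simpa using h x hx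
    exact (show natDegree _ ≤ 4 by compute_degree).trans (by norm_num)
  have hcoeff (i : ℕ) := congrArg (coeff · i) hP
  refine ⟨?_, ?_, ?_, ?_, ?_⟩
  · simpa [coeff_C, coeff_X] using hcoeff 0
  · simpa [coeff_C, coeff_X] using hcoeff 1
  · simpa [coeff_C, coeff_X] using hcoeff 2
  · simpa [coeff_C, coeff_X] using hcoeff 3
  · simpa [coeff_C, coeff_X] using hcoeff 4

theorem QuadRoot.algebraMap_norm_ne_zero (hθ : QuadRoot τ K θ) (v : k) :
    algebraMap k K v * algebraMap k K v - algebraMap k K v + algebraMap k K τ ≠ 0 := by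
  intro h
  have hfactor : (θ - algebraMap k K v) * (θ - (1 - algebraMap k K v)) = 0 := by
    linear_combination hθ.root - h
  rcases mul_eq_zero.1 hfactor with h | h
  · exact one_ne_zero (hθ.indep 1 (-v) (by simpa [sub_eq_add_neg] using h)).1
  · exact one_ne_zero (hθ.indep 1 (v - 1) (by
      rw [map_one, map_sub, map_one]; linear_combination h)).1

/-- The point with `v` in the base field. -/
def QuadRoot.point (hθ : QuadRoot τ K θ) (v : k) (x : K) (hx : x ≠ 0) : FieldPoint τ K :=
  ⟨(algebraMap k K v, x), hθ.algebraMap_norm_ne_zero v, hx⟩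

/-- On each line of constant `x` the function `g` is a polynomial in `v` of degree at most `d`,
whose value at the excluded point `v = θ` is `h x`. -/
def RestrictsTo (θ : K) (d : ℕ) (g : FieldPoint τ K → K) (h : K → K) : Prop :=
  ∃ P : K → K[X], (∀ x, (P x).natDegree ≤ d) ∧ (∀ ω, g ω = (P ω.1.2).eval ω.1.1) ∧
    ∀ x, h x = (P x).eval θ

section RestrictsTo

variable {g g' : FieldPoint τ K → K} {h h' : K → K}

theorem RestrictsTo.mono (hg : RestrictsTo θ d g h) (hd : d ≤ d') : RestrictsTo θ d' g h := by
  obtain ⟨P, hP, hgP, hhP⟩ := hg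
  exact ⟨P, fun x => (hP x).trans hd, hgP, hhP⟩

theorem RestrictsTo.add (hg : RestrictsTo θ d g h) (hg' : RestrictsTo θ d g' h') :
    RestrictsTo θ d (g + g') (h + h') := by
  obtain ⟨P, hP, hgP, hhP⟩ := hg
  obtain ⟨P', hP', hgP', hhP'⟩ := hg'
  exact ⟨fun x => P x + P' x, fun x => natDegree_add_le_of_degree_le (hP x) (hP' x),
    fun ω => by simp [hgP, hgP'], fun x => by simp [hhP, hhP']⟩

theorem RestrictsTo.mul (hg : RestrictsTo θ d g h) (hg' : RestrictsTo θ d' g' h') :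
    RestrictsTo θ (d + d') (g * g') (h * h') := by
  obtain ⟨P, hP, hgP, hhP⟩ := hg
  obtain ⟨P', hP', hgP', hhP'⟩ := hg'
  exact ⟨fun x => P x * P' x, fun x => natDegree_mul_le.trans (add_le_add (hP x) (hP' x)),
    fun ω => by simp [hgP, hgP'], fun x => by simp [hhP, hhP']⟩

theorem restrictsTo_snd (θ : K) (d : ℕ) (h : K → K) :
    RestrictsTo θ d (fun ω : FieldPoint τ K => h ω.1.2) h :=
  ⟨fun x => C (h x), fun x => by simp, fun ω => by simp, fun x => by simp⟩

theorem RestrictsTo.smul (c : k) (hg : RestrictsTo θ d g h) : RestrictsTo θ d (c • g) (c • h) := by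
  have hmul := (restrictsTo_snd (τ := τ) θ 0 fun _ => algebraMap k K c).mul hg
  rw [zero_add] at hmul
  convert hmul using 1 <;> ext <;> simp [Algebra.smul_def]

end RestrictsTo

/-- The input `A = v x`. -/
def fieldA : FieldPoint τ K → K := fun ω => ω.1.1 * ω.1.2

/-- The input `B = x`. -/
def fieldB : FieldPoint τ K → K := fun ω => ω.1.2

/-- The inverse `x⁻¹` of the input `B`. -/
def fieldR : FieldPoint τ K → K := fun ω => ω.1.2⁻¹

/-- The function `(α v + β) / ((v² - v + τ) x)`. These functions are the linear combinations of the
two components of `(A + ξ B)⁻¹`. -/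
def normQuotient (α β : k) : FieldPoint τ K → K := fun ω =>
  (algebraMap k K α * ω.1.1 + algebraMap k K β) /
    ((ω.1.1 * ω.1.1 - ω.1.1 + algebraMap k K τ) * ω.1.2)

theorem normQuotient_mul (α β : k) (ω : FieldPoint τ K) :
    normQuotient α β ω * ((ω.1.1 * ω.1.1 - ω.1.1 + algebraMap k K τ) * ω.1.2) =
      algebraMap k K α * ω.1.1 + algebraMap k K β :=
  div_mul_cancel₀ _ (mul_ne_zero ω.2.1 ω.2.2)

variable {α β : k}

-- `normQuotient α β` has a pole along `v = θ`, which every denominator has to cancel.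
theorem QuadRoot.restriction_eq_zero (hθ : QuadRoot τ K θ) (hαβ : α ≠ 0 ∨ β ≠ 0)
    {m : FieldPoint τ K → K} {h h' : K → K} (hm : RestrictsTo θ 8 m h)
    (hmT : RestrictsTo θ 8 (m * normQuotient α β) h') {x : K} (hx : x ≠ 0) : h x = 0 := by
  obtain ⟨P, hP, hmP, hhP⟩ := hm
  obtain ⟨Q, hQ, hmQ, -⟩ := hmT
  have hnorm := natDegree_normPoly (τ := τ) (K := K)
  have hzero : (C (algebraMap k K α) * X + C (algebraMap k K β)) * P x -
      normPoly τ K * (C x * Q x) = 0 := by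
    refine hθ.eq_zero_of_eval_eq_zero (ne_zero_of_natDegree_gt (n := 0) (by rw [hnorm]; omega)) ?_
      fun v hv => ?_
    · have hlin : (C (algebraMap k K α) * X + C (algebraMap k K β)).natDegree ≤ 1 := by
        compute_degree
      have hPx := hP x
      have hQx := (natDegree_C_mul_le x (Q x)).trans (hQ x)
      have hdeg := natDegree_sub_le_of_le
        (natDegree_mul_le_of_le hlin hPx) (natDegree_mul_le_of_le hnorm.le hQx)
      omega
    · rw [eval_normPoly] at hv
      have hT := normQuotient_mul α β ⟨(v, x), hv, hx⟩
      have hvx := hmQ ⟨(v, x), hv, hx⟩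
      rw [Pi.mul_apply, hmP] at hvx
      simp only [eval_sub, eval_mul, eval_add, eval_C, eval_X, eval_normPoly]
      linear_combination ((v * v - v + algebraMap k K τ) * x) * hvx - (P x).eval v * hT
  have hθx := congrArg (eval θ) hzero
  rw [eval_sub, eval_mul, eval_mul, hθ.eval_normPoly_eq_zero, zero_mul, sub_zero, eval_zero,
    ← hhP, mul_eq_zero] at hθx
  refine hθx.resolve_left fun hlin => ?_
  obtain ⟨hα, hβ⟩ := hθ.indep α β (by simpa using hlin)
  exact hαβ.elim (· hα) (· hβ)

theorem QuadRoot.not_restrictsTo_normQuotient (hθ : QuadRoot τ K θ) (hαβ : α ≠ 0 ∨ β ≠ 0)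
    (h : K → K) : ¬RestrictsTo (τ := τ) θ 8 (normQuotient α β) h := fun hT =>
  one_ne_zero (hθ.restriction_eq_zero hαβ (restrictsTo_snd (τ := τ) θ 8 1)
    (by simpa only [Pi.one_apply, ← Pi.one_def, one_mul] using hT) (one_ne_zero (α := K)))

theorem QuadRoot.exists_mul_sub_eq (hθ : QuadRoot τ K θ) (hαβ : α ≠ 0 ∨ β ≠ 0)
    {W : Submodule k (FieldPoint τ K → K)} (hW : ∀ g ∈ W, ∃ h, RestrictsTo θ 4 g h)
    {y : FieldPoint τ K → K} (hy : IsProdOrInv W y)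
    (hT : normQuotient α β ∈ W ⊔ Submodule.span k {y}) :
    ∃ g ∈ W, ∃ w ∈ W, ∃ c : k, c ≠ 0 ∧ g * (normQuotient α β - w) = c • 1 := by
  obtain ⟨w, hw, c, hTw⟩ := mem_sup_span_singleton.1 hT
  obtain ⟨hw', hww'⟩ := hW w hw
  have hc : c ≠ 0 := by
    rintro rfl
    refine hθ.not_restrictsTo_normQuotient hαβ hw' ?_
    rw [hTw, zero_smul, add_zero]
    exact hww'.mono (by norm_num)
  rcases hy with ⟨P, hP, Q, hQ, rfl⟩ | ⟨g, hg, hgy, -⟩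
  · obtain ⟨hP', hPP'⟩ := hW P hP
    obtain ⟨hQ', hQQ'⟩ := hW Q hQ
    refine absurd ?_ (hθ.not_restrictsTo_normQuotient hαβ (hw' + c • (hP' * hQ')))
    rw [hTw]
    exact (hww'.mono (by norm_num)).add ((hPP'.mul hQQ').smul c)
  · refine ⟨g, hg, w, hw, c, hc, ?_⟩
    rw [hTw, add_sub_cancel_left, mul_smul_comm, hgy]

theorem QuadRoot.restriction_eq_zero_of_mul_sub_eq (hθ : QuadRoot τ K θ) (hαβ : α ≠ 0 ∨ β ≠ 0)
    {g w : FieldPoint τ K → K} {h h' : K → K} (hg : RestrictsTo θ 4 g h)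
    (hw : RestrictsTo θ 4 w h') {c : k} (hgw : g * (normQuotient α β - w) = c • 1) {x : K}
    (hx : x ≠ 0) : h x = 0 := by
  refine hθ.restriction_eq_zero hαβ (hg.mono (by norm_num)) (h' := h * h' + c • 1) ?_ hx
  have hgT : g * normQuotient α β = g * w + c • 1 := by rw [← hgw]; ring
  rw [hgT]
  exact (hg.mul hw).add ((restrictsTo_snd θ 8 1).smul c)

end FieldPoints

section ThreeSteps

open Polynomial Submodule

variable {k : Type*} [Field k] {K : Type*} [Field K] [Algebra k K] {τ : k} {θ : K} {α β : k}
  {d : ℕ} {g y z : FieldPoint τ K → K}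

local notation "φ" => algebraMap k K

/-- The linear form `p A + q B` in the inputs. -/
def linearForm (p q : k) : FieldPoint τ K → K := fun ω => (φ p * ω.1.1 + φ q) * ω.1.2

theorem mem_span_one_fieldA_fieldB :
    g ∈ span k {1, fieldA, fieldB} ↔ ∃ p₀ p₁ p₂ : k, ∀ ω, g ω = φ p₀ + linearForm p₁ p₂ ω := by
  simp only [mem_span_triple, funext_iff, @eq_comm _ _ (g _), Pi.add_apply, Pi.smul_apply,
    Pi.one_apply]
  simp only [Algebra.smul_def, linearForm, fieldA, fieldB, mul_one, add_mul, mul_assoc, add_assoc]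

theorem mem_span_sup_span_singleton :
    g ∈ span k {1, fieldA, fieldB} ⊔ span k {y} ↔
      ∃ p₀ p₁ p₂ p₃ : k, ∀ ω, g ω = φ p₀ + linearForm p₁ p₂ ω + φ p₃ * y ω := by
  rw [mem_sup_span_singleton]
  constructor
  · rintro ⟨w, hw, p₃, rfl⟩
    obtain ⟨p₀, p₁, p₂, hw⟩ := mem_span_one_fieldA_fieldB.1 hw
    exact ⟨p₀, p₁, p₂, p₃, fun ω => by simp [hw, Algebra.smul_def]⟩
  · rintro ⟨p₀, p₁, p₂, p₃, hg⟩
    refine ⟨fun ω => φ p₀ + linearForm p₁ p₂ ω, mem_span_one_fieldA_fieldB.2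
      ⟨p₀, p₁, p₂, fun _ => rfl⟩, p₃, ?_⟩
    ext ω
    simp [hg, Algebra.smul_def]

theorem restrictsTo_of_eq_add {p₀ p₁ p₂ p₃ : k} {h : K → K}
    (hg : ∀ ω, g ω = φ p₀ + linearForm p₁ p₂ ω + φ p₃ * y ω) (hd : 1 ≤ d)
    (hy : RestrictsTo θ d y h) :
    RestrictsTo θ d g fun x => φ p₀ + (φ p₁ * θ + φ p₂) * x + φ p₃ * h x := by
  obtain ⟨P, hP, hyP, hhP⟩ := hy
  refine ⟨fun x => C (φ p₀) + (C (φ p₁) * X + C (φ p₂)) * C x + C (φ p₃) * P x, fun x => ?_,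
    fun ω => by simp [hg, hyP, linearForm], fun x => by simp [hhP]⟩
  refine natDegree_add_le_of_degree_le ?_ ((natDegree_C_mul_le _ _).trans (hP x))
  refine (show natDegree _ ≤ 1 by compute_degree).trans hd

theorem QuadRoot.eq_zero_of_mul_eq_one (hθ : QuadRoot τ K θ) {p₀ p₁ p₂ p₃ : k}
    (hg : ∀ ω, g ω = φ p₀ + linearForm p₁ p₂ ω + φ p₃ * fieldR ω) (hgz : g * z = 1) :
    p₁ = 0 := by
  by_contra hp₁
  let ω := hθ.point (-(p₀ + p₂ + p₃) / p₁) 1 one_ne_zero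
  have hgω : g ω = φ (p₀ + (p₁ * (-(p₀ + p₂ + p₃) / p₁) + p₂) + p₃) := by
    simp [hg, ω, QuadRoot.point, linearForm, fieldR]
  have hzero : p₀ + (p₁ * (-(p₀ + p₂ + p₃) / p₁) + p₂) + p₃ = 0 := by
    rw [mul_div_cancel₀ _ hp₁]
    ring
  rw [hzero, map_zero] at hgω
  simpa [hgω] using congrFun hgz ω

theorem QuadRoot.mem_of_inv (hθ : QuadRoot τ K θ) {p₀ p₁ p₂ : k}
    (hg : ∀ ω, g ω = φ p₀ + linearForm p₁ p₂ ω) (hgz : g * z = 1) :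
    z ∈ span k {1, fieldA, fieldB} ⊔ span k {fieldR} := by
  obtain rfl : p₁ = 0 := hθ.eq_zero_of_mul_eq_one (p₀ := p₀) (p₂ := p₂) (p₃ := 0)
    (fun ω => by simp [hg]) hgz
  have hgz' (ω) : (φ p₀ + φ p₂ * ω.1.2) * z ω = 1 := by
    simpa [hg, linearForm] using congrFun hgz ω
  rw [mem_span_sup_span_singleton]
  by_cases hp₂ : p₂ = 0
  · refine ⟨p₀⁻¹, 0, 0, 0, fun ω => ?_⟩
    have hω := hgz' ω
    rw [hp₂, map_zero, zero_mul, add_zero] at hω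
    simpa [linearForm] using eq_inv_of_mul_eq_one_right hω
  have hp₀ : p₀ = 0 := by
    by_contra hp₀
    have hx : φ (-p₀ / p₂) ≠ 0 := by simp [hp₀, hp₂]
    have hω := hgz' (hθ.point 0 _ hx)
    rw [QuadRoot.point, ← map_mul, mul_div_cancel₀ _ hp₂, map_neg, add_neg_cancel, zero_mul] at hω
    exact zero_ne_one hω
  refine ⟨0, 0, 0, p₂⁻¹, fun ω => ?_⟩
  have hω := hgz' ω
  rw [hp₀, map_zero, zero_add] at hω
  simpa [linearForm, fieldR, mul_comm] using eq_inv_of_mul_eq_one_right hω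

theorem QuadRoot.mem_of_isProdOrInv (hθ : QuadRoot τ K θ)
    (hz : IsProdOrInv (span k {1, fieldA, fieldB}) z) :
    z ∈ span k {1, fieldA, fieldB} ⊔ span k {fieldR} ∨ ∃ l₁ l₂ m₁ m₂ : k,
      z ∈ span k {1, fieldA, fieldB} ⊔ span k {linearForm l₁ l₂ * linearForm m₁ m₂} := by
  rcases hz with ⟨P, hP, Q, hQ, rfl⟩ | ⟨P, hP, hPz, -⟩
  · obtain ⟨p₀, p₁, p₂, hP⟩ := mem_span_one_fieldA_fieldB.1 hP
    obtain ⟨q₀, q₁, q₂, hQ⟩ := mem_span_one_fieldA_fieldB.1 hQ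
    refine .inr ⟨p₁, p₂, q₁, q₂, mem_span_sup_span_singleton.2
      ⟨p₀ * q₀, p₀ * q₁ + p₁ * q₀, p₀ * q₂ + p₂ * q₀, 1, fun ω => ?_⟩⟩
    simp only [Pi.mul_apply, hP, hQ, linearForm, map_add, map_mul, map_one]
    ring
  · obtain ⟨p₀, p₁, p₂, hP⟩ := mem_span_one_fieldA_fieldB.1 hP
    exact .inl (hθ.mem_of_inv hP hPz)

theorem QuadRoot.normQuotient_notMem_of_exists_eq_zero (hθ : QuadRoot τ K θ) (hαβ : α ≠ 0 ∨ β ≠ 0)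
    {W : Submodule k (FieldPoint τ K → K)}
    (hW : ∀ g ∈ W, ∃ h, RestrictsTo θ 4 g h ∧ ((∀ x, x ≠ 0 → h x = 0) → ∃ ω, g ω = 0))
    (hy : IsProdOrInv W y) : normQuotient α β ∉ W ⊔ span k {y} := by
  intro hT
  have hpoly (g) (hg : g ∈ W) : ∃ h, RestrictsTo θ 4 g h := (hW g hg).imp fun _ => And.left
  obtain ⟨g, hg, w, hw, c, hc, hgw⟩ := hθ.exists_mul_sub_eq hαβ hpoly hy hT
  obtain ⟨h, hgh, hzero⟩ := hW g hg
  obtain ⟨h', hwh'⟩ := hpoly w hw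
  obtain ⟨ω, hω⟩ := hzero fun x hx => hθ.restriction_eq_zero_of_mul_sub_eq hαβ hgh hwh' hgw hx
  have hcω := congrFun hgw ω
  rw [Pi.mul_apply, hω, zero_mul, Pi.smul_apply, Pi.one_apply, Algebra.smul_def, mul_one] at hcω
  exact hc ((map_eq_zero _).1 hcω.symm)

theorem QuadRoot.normQuotient_notMem_of_inv_inv (hθ : QuadRoot τ K θ) (hαβ : α ≠ 0 ∨ β ≠ 0)
    {P : FieldPoint τ K → K} (hP : P ∈ span k {1, fieldA, fieldB} ⊔ span k {fieldR})
    (hPz : P * z = 1)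
    (hy : IsProdOrInv (span k {1, fieldA, fieldB} ⊔ span k {fieldR} ⊔ span k {z}) y) :
    normQuotient α β ∉ span k {1, fieldA, fieldB} ⊔ span k {fieldR} ⊔ span k {z} ⊔ span k {y} := by
  obtain ⟨p₀, p₁, p₂, p₃, hP⟩ := mem_span_sup_span_singleton.1 hP
  obtain rfl := hθ.eq_zero_of_mul_eq_one hP hPz
  let f (x : K) : K := (φ p₀ + φ p₂ * x + φ p₃ * x⁻¹)⁻¹
  have hzf : z = fun ω => f ω.1.2 := by
    ext ω
    refine eq_inv_of_mul_eq_one_right ?_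
    simpa [hP, linearForm, fieldR] using congrFun hPz ω
  refine hθ.normQuotient_notMem_of_exists_eq_zero hαβ (fun g hg => ?_) hy
  obtain ⟨w, hw, e, rfl⟩ := mem_sup_span_singleton.1 hg
  obtain ⟨w₀, w₁, w₂, w₃, hw⟩ := mem_span_sup_span_singleton.1 hw
  have hz : RestrictsTo θ 4 z f := hzf ▸ restrictsTo_snd θ 4 f
  refine ⟨_, (restrictsTo_of_eq_add hw (by norm_num) (restrictsTo_snd θ 4 (·⁻¹))).add (hz.smul e),
    fun hzero => ⟨hθ.point 0 1 one_ne_zero, ?_⟩⟩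
  have hone := hzero 1 one_ne_zero
  rw [Pi.add_apply, Pi.smul_apply, Algebra.smul_def] at hone
  simp only [f, inv_one, mul_one] at hone
  have hk := (hθ.indep w₁ (w₀ + w₂ + w₃ + e * (p₀ + p₂ + p₃)⁻¹) (by
    simp only [map_add, map_mul, map_inv₀]
    linear_combination hone)).2
  have hφ := congrArg φ hk
  simp only [map_add, map_mul, map_inv₀, map_zero] at hφ
  rw [Pi.add_apply, Pi.smul_apply, Algebra.smul_def, hw, hzf]
  simp only [f, QuadRoot.point, linearForm, fieldR, inv_one, mul_one, map_zero, mul_zero, zero_add]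
  linear_combination hφ

theorem QuadRoot.normQuotient_notMem_of_inv_mul (hθ : QuadRoot τ K θ) (hαβ : α ≠ 0 ∨ β ≠ 0)
    {P Q : FieldPoint τ K → K} (hP : P ∈ span k {1, fieldA, fieldB} ⊔ span k {fieldR})
    (hQ : Q ∈ span k {1, fieldA, fieldB} ⊔ span k {fieldR})
    (hy : IsProdOrInv (span k {1, fieldA, fieldB} ⊔ span k {fieldR} ⊔ span k {P * Q}) y) :
    normQuotient α β ∉
      span k {1, fieldA, fieldB} ⊔ span k {fieldR} ⊔ span k {P * Q} ⊔ span k {y} := by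
  obtain ⟨p₀, p₁, p₂, p₃, hP⟩ := mem_span_sup_span_singleton.1 hP
  obtain ⟨q₀, q₁, q₂, q₃, hQ⟩ := mem_span_sup_span_singleton.1 hQ
  refine hθ.normQuotient_notMem_of_exists_eq_zero hαβ (fun g hg => ?_) hy
  obtain ⟨w, hw, c, rfl⟩ := mem_sup_span_singleton.1 hg
  obtain ⟨w₀, w₁, w₂, w₃, hw⟩ := mem_span_sup_span_singleton.1 hw
  have hR (d : ℕ) : RestrictsTo (τ := τ) θ d fieldR (·⁻¹) := restrictsTo_snd θ d _
  refine ⟨_, (restrictsTo_of_eq_add hw (by norm_num) (hR 4)).add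
    (((restrictsTo_of_eq_add hP (by norm_num) (hR 2)).mul
      (restrictsTo_of_eq_add hQ (by norm_num) (hR 2))).smul c),
    fun hzero => ⟨hθ.point 0 1 one_ne_zero, ?_⟩⟩
  obtain ⟨h₀, h₁, h₂, h₃, h₄⟩ := hθ.coeff_eq_zero (s₀ := φ (c * p₃ * q₃))
    (s₁ := φ (w₃ + c * (p₀ * q₃ + p₃ * q₀)))
    (s₂ := φ (c * (p₃ * q₁ + q₃ * p₁)) * θ + φ (w₀ + c * (p₀ * q₀ + p₃ * q₂ + q₃ * p₂)))
    (s₃ := φ (w₁ + c * (p₀ * q₁ + q₀ * p₁)) * θ + φ (w₂ + c * (p₀ * q₂ + q₀ * p₂)))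
    (s₄ := φ c * (φ p₁ * θ + φ p₂) * (φ q₁ * θ + φ q₂)) fun x hx => by
      have hx' := hzero x hx
      rw [Pi.add_apply, Pi.smul_apply, Pi.mul_apply, Algebra.smul_def] at hx'
      field_simp at hx'
      simp only [map_add, map_mul]
      linear_combination hx'
  have h₂' := (hθ.indep _ _ h₂).2
  have h₃' := (hθ.indep _ _ h₃).2
  have h₄' : c * p₂ * q₂ = 0 := by
    simp only [mul_eq_zero, map_eq_zero] at h₄ ⊢
    exact h₄.imp (.imp id fun h => (hθ.indep _ _ h).2) fun h => (hθ.indep _ _ h).2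
  have hsum : w₀ + w₂ + w₃ + c * ((p₀ + p₂ + p₃) * (q₀ + q₂ + q₃)) = 0 := by
    linear_combination (map_eq_zero _).1 h₀ + (map_eq_zero _).1 h₁ + h₂' + h₃' + h₄'
  simpa [hw, hP, hQ, QuadRoot.point, linearForm, fieldR, Algebra.smul_def] using congrArg φ hsum

variable {l₁ l₂ m₁ m₂ : k}

theorem restrictsTo_linearForm_mul_linearForm (θ : K) (l₁ l₂ m₁ m₂ : k) :
    RestrictsTo (τ := τ) θ 2 (linearForm l₁ l₂ * linearForm m₁ m₂)
      fun x => (φ l₁ * θ + φ l₂) * (φ m₁ * θ + φ m₂) * x ^ 2 := by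
  refine ⟨fun x => (C (φ l₁) * X + C (φ l₂)) * (C (φ m₁) * X + C (φ m₂)) * C (x ^ 2),
    fun x => (natDegree_mul_C_le _ _).trans (by compute_degree), fun ω => ?_, fun x => by simp⟩
  simp only [Pi.mul_apply, linearForm, eval_mul, eval_add, eval_C, eval_X]
  ring

theorem exists_coeff_of_mem_sup_span_mul (θ : K) {P Q : FieldPoint τ K → K}
    (hP : P ∈ span k {1, fieldA, fieldB} ⊔ span k {linearForm l₁ l₂ * linearForm m₁ m₂})
    (hQ : Q ∈ span k {1, fieldA, fieldB} ⊔ span k {linearForm l₁ l₂ * linearForm m₁ m₂})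
    (hg : g ∈ span k {1, fieldA, fieldB} ⊔ span k {linearForm l₁ l₂ * linearForm m₁ m₂} ⊔
      span k {P * Q}) :
    ∃ (a₀ a₁ b₁ : k) (a₂ a₃ a₄ : K → K),
      (∀ ω, g ω = φ a₀ + (φ a₁ * ω.1.1 + φ b₁) * ω.1.2 + a₂ ω.1.1 * ω.1.2 ^ 2 +
        a₃ ω.1.1 * ω.1.2 ^ 3 + a₄ ω.1.1 * ω.1.2 ^ 4) ∧
      RestrictsTo θ 4 g fun x => φ a₀ + (φ a₁ * θ + φ b₁) * x + a₂ θ * x ^ 2 +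
        a₃ θ * x ^ 3 + a₄ θ * x ^ 4 := by
  obtain ⟨w, hw, c, rfl⟩ := mem_sup_span_singleton.1 hg
  obtain ⟨w₀, w₁, w₂, w₃, hw⟩ := mem_span_sup_span_singleton.1 hw
  obtain ⟨p₀, p₁, p₂, p₃, hP⟩ := mem_span_sup_span_singleton.1 hP
  obtain ⟨q₀, q₁, q₂, q₃, hQ⟩ := mem_span_sup_span_singleton.1 hQ
  let lm (v : K) : K := (φ l₁ * v + φ l₂) * (φ m₁ * v + φ m₂)
  let p (v : K) : K := φ p₁ * v + φ p₂
  let q (v : K) : K := φ q₁ * v + φ q₂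
  refine ⟨w₀ + c * p₀ * q₀, w₁ + c * (p₀ * q₁ + q₀ * p₁), w₂ + c * (p₀ * q₂ + q₀ * p₂),
    fun v => φ w₃ * lm v + φ c * (φ p₀ * φ q₃ * lm v + p v * q v + φ q₀ * φ p₃ * lm v),
    fun v => φ c * (p v * φ q₃ * lm v + q v * φ p₃ * lm v),
    fun v => φ c * φ p₃ * φ q₃ * lm v ^ 2, fun ω => ?_, ?_⟩
  · rw [Pi.add_apply, Pi.smul_apply, Pi.mul_apply, Algebra.smul_def, hw, hP, hQ]
    simp only [Pi.mul_apply, linearForm, lm, p, q, map_add, map_mul]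
    ring
  · have hlm := restrictsTo_linearForm_mul_linearForm (τ := τ) θ l₁ l₂ m₁ m₂
    convert (restrictsTo_of_eq_add hw (by norm_num) (hlm.mono (by norm_num : 2 ≤ 4))).add
      (((restrictsTo_of_eq_add hP (by norm_num) hlm).mul
        (restrictsTo_of_eq_add hQ (by norm_num) hlm)).smul c) using 1
    ext x
    rw [Pi.add_apply, Pi.smul_apply, Pi.mul_apply, Algebra.smul_def]
    simp only [lm, p, q, map_add, map_mul]
    ring

-- On the line `v = 0` a denominator divisible by `x²` cannot cancel the simple pole at `x = 0`.
theorem QuadRoot.mul_sub_ne_of_sq_dvd (hθ : QuadRoot τ K θ) {g w : FieldPoint τ K → K}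
    {G W : K[X]} (hG : G.natDegree ≤ 4) (hW : W.natDegree ≤ 4)
    (hgG : ∀ x hx, g (hθ.point 0 x hx) = x ^ 2 * G.eval x)
    (hwW : ∀ x hx, w (hθ.point 0 x hx) = W.eval x) {c : k} (hc : c ≠ 0) :
    g * (normQuotient α β - w) ≠ c • 1 := by
  intro hgw
  have hpoly : X * G * (C (φ β) - C (φ τ) * X * W) - C (φ c * φ τ) = 0 := by
    refine hθ.eq_zero_of_eval_eq_zero_of_ne_zero ?_ fun x hx => ?_
    · have hX := natDegree_mul_le_of_le (natDegree_X_le (R := K)) hG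
      have hCX := natDegree_mul_le_of_le
        ((natDegree_C_mul_le (φ τ) X).trans natDegree_X_le) hW
      have hdeg := natDegree_sub_le_of_le (natDegree_mul_le_of_le hX
        (natDegree_sub_le_of_le (natDegree_C (φ β)).le hCX)) (natDegree_C (φ c * φ τ)).le
      omega
    · have hgx := congrFun hgw (hθ.point 0 x hx)
      rw [Pi.mul_apply, Pi.sub_apply, hgG, hwW, Pi.smul_apply, Pi.one_apply, Algebra.smul_def,
        mul_one] at hgx
      have hT := normQuotient_mul α β (hθ.point 0 x hx)
      have hv : (hθ.point 0 x hx).1 = (0, x) := by simp [QuadRoot.point]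
      rw [hv] at hT
      simp only [eval_sub, eval_mul, eval_C, eval_X]
      refine mul_left_cancel₀ hx ?_
      linear_combination φ τ * x * hgx - x ^ 2 * G.eval x * hT
  have hτ : φ τ ≠ 0 := by simpa using hθ.algebraMap_norm_ne_zero 0
  simpa [hc, hτ] using congrArg (eval 0) hpoly

theorem QuadRoot.normQuotient_notMem_of_mul_mul (hθ : QuadRoot τ K θ) (hαβ : α ≠ 0 ∨ β ≠ 0)
    {P Q : FieldPoint τ K → K}
    (hP : P ∈ span k {1, fieldA, fieldB} ⊔ span k {linearForm l₁ l₂ * linearForm m₁ m₂})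
    (hQ : Q ∈ span k {1, fieldA, fieldB} ⊔ span k {linearForm l₁ l₂ * linearForm m₁ m₂})
    (hy : IsProdOrInv (span k {1, fieldA, fieldB} ⊔
      span k {linearForm l₁ l₂ * linearForm m₁ m₂} ⊔ span k {P * Q}) y) :
    normQuotient α β ∉ span k {1, fieldA, fieldB} ⊔
      span k {linearForm l₁ l₂ * linearForm m₁ m₂} ⊔ span k {P * Q} ⊔ span k {y} := by
  intro hT
  obtain ⟨g, hg, w, hw, c, hc, hgw⟩ := hθ.exists_mul_sub_eq hαβ (fun g hg => by
    obtain ⟨_, _, _, _, _, _, -, hres⟩ := exists_coeff_of_mem_sup_span_mul θ hP hQ hg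
    exact ⟨_, hres⟩) hy hT
  obtain ⟨a₀, a₁, b₁, a₂, a₃, a₄, hga, hgres⟩ := exists_coeff_of_mem_sup_span_mul θ hP hQ hg
  obtain ⟨e₀, e₁, f₁, e₂, e₃, e₄, hwe, hwres⟩ := exists_coeff_of_mem_sup_span_mul θ hP hQ hw
  obtain ⟨ha₀, ha₁, -⟩ := hθ.coeff_eq_zero fun x hx =>
    hθ.restriction_eq_zero_of_mul_sub_eq hαβ hgres hwres hgw hx
  have hb₁ := (hθ.indep _ _ ha₁).2
  refine hθ.mul_sub_ne_of_sq_dvd (G := C (a₂ 0) + C (a₃ 0) * X + C (a₄ 0) * X ^ 2)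
    (W := C (φ e₀) + C (φ f₁) * X + C (e₂ 0) * X ^ 2 + C (e₃ 0) * X ^ 3 + C (e₄ 0) * X ^ 4)
    ((show natDegree _ ≤ 2 by compute_degree).trans (by norm_num)) (by compute_degree)
    (fun x hx => ?_) (fun x hx => ?_) hc hgw
  · rw [hga, ha₀, hb₁]
    simp only [QuadRoot.point, map_zero, mul_zero, eval_add, eval_mul, eval_C, eval_X, eval_pow]
    ring
  · rw [hwe]
    simp only [QuadRoot.point, map_zero, mul_zero, zero_add, eval_add, eval_mul, eval_C, eval_X,
      eval_pow]

theorem QuadRoot.exists_restrictsTo_eval (hθ : QuadRoot τ K θ)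
    (hg : g ∈ span k {1, fieldA, fieldB} ⊔ span k {linearForm l₁ l₂ * linearForm m₁ m₂}) :
    ∃ p : K[X], p.natDegree ≤ 2 ∧ RestrictsTo θ 2 g (fun x => p.eval x) ∧
      ∀ s, p = C s → ∀ ω, g ω = s := by
  obtain ⟨p₀, p₁, p₂, p₃, hg⟩ := mem_span_sup_span_singleton.1 hg
  let p : K[X] := C (φ p₀) + C (φ p₁ * θ + φ p₂) * X +
    C (φ p₃ * ((φ l₁ * θ + φ l₂) * (φ m₁ * θ + φ m₂))) * X ^ 2
  refine ⟨p, by simp only [p]; compute_degree, ?_, fun s hs ω => ?_⟩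
  · convert restrictsTo_of_eq_add hg (by norm_num)
      (restrictsTo_linearForm_mul_linearForm θ l₁ l₂ m₁ m₂) using 2 with x
    simp [p, mul_assoc]
  · have h₀ := congrArg (coeff · 0) hs
    have h₁ := congrArg (coeff · 1) hs
    have h₂ := congrArg (coeff · 2) hs
    simp only [p, coeff_add, coeff_C_mul, coeff_X_pow, coeff_X, coeff_C] at h₀ h₁ h₂
    norm_num at h₀ h₁ h₂
    have hlin : linearForm (τ := τ) p₁ p₂ ω = 0 := by simp [linearForm, hθ.indep _ _ h₁]
    have hprod : φ p₃ * (linearForm l₁ l₂ ω * linearForm m₁ m₂ ω) = 0 := by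
      rcases h₂ with h | h | h
      · simp [h]
      · simp [linearForm, hθ.indep _ _ h]
      · simp [linearForm, hθ.indep _ _ h]
    rw [hg, Pi.mul_apply, hprod, hlin, h₀, add_zero, add_zero]

section MulInv

variable {P Q Q' w : FieldPoint τ K → K} {p q q' h : K → K} {c e d d' : k}

theorem QuadRoot.eq_zero_of_eq_add_smul_mul (hθ : QuadRoot τ K θ) (hαβ : α ≠ 0 ∨ β ≠ 0)
    (hP : RestrictsTo θ 2 P p) (hQ : RestrictsTo θ 2 Q q) (hQ' : RestrictsTo θ 2 Q' q')
    (hw : RestrictsTo θ 2 w h) (hPz : P * z = 1)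
    (hT : normQuotient α β = w + e • z + c • ((Q + d • z) * (Q' + d' • z))) {x : K} (hx : x ≠ 0) :
    p x = 0 := by
  have hconst (s : k) : RestrictsTo (τ := τ) θ 4 (s • 1) (s • 1) := (restrictsTo_snd θ 4 1).smul s
  have hmT : P * P * normQuotient α β =
      w * P * P + e • P + c • ((Q * P + d • 1) * (Q' * P + d' • 1)) := by
    rw [hT, ← hPz]
    simp only [Algebra.smul_def]
    linear_combination (algebraMap k _ e * P) * hPz
  have hP8 := (hP.mul hP).mono (by norm_num : 2 + 2 ≤ 8)
  have hmT8 := (((hw.mul hP).mul hP).mono (by norm_num)).add ((hP.mono (by norm_num)).smul e) |>.add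
    ((((hQ.mul hP).add (hconst d)).mul ((hQ'.mul hP).add (hconst d'))).smul c)
  exact mul_self_eq_zero.1 (hθ.restriction_eq_zero hαβ hP8 (hmT ▸ hmT8) hx)

theorem QuadRoot.mul_eq_zero_of_eq_add_smul_inv (hθ : QuadRoot τ K θ) (hαβ : α ≠ 0 ∨ β ≠ 0)
    (hP : RestrictsTo θ 2 P p) (hQ : RestrictsTo θ 2 Q q) (hw : RestrictsTo θ 2 w h)
    (hPz : P * z = 1) (hy : (Q + d • z) * y = 1) (hT : normQuotient α β = w + e • z + c • y)
    {x : K} (hx : x ≠ 0) : p x * (q x * p x + φ d) = 0 := by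
  have hconst (s : k) : RestrictsTo (τ := τ) θ 4 (s • 1) (s • 1) := (restrictsTo_snd θ 4 1).smul s
  have hden := (hQ.mul hP).add (hconst d)
  have hy' : (Q * P + d • 1) * y = P := by
    simp only [Algebra.smul_def] at hy ⊢
    linear_combination P * hy - algebraMap k _ d * y * hPz
  have hmT : P * (Q * P + d • 1) * normQuotient α β =
      (w * P + e • 1) * (Q * P + d • 1) + c • (P * P) := by
    rw [hT]
    simp only [Algebra.smul_def] at hy' ⊢
    linear_combination (algebraMap k _ e * (Q * P + algebraMap k _ d * 1)) * hPz +
      algebraMap k _ c * P * hy'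
  have hmT8 := (((hw.mul hP).add (hconst e)).mul hden).add
    (((hP.mul hP).mono (by norm_num : 2 + 2 ≤ 8)).smul c)
  simpa [Algebra.smul_def] using
    hθ.restriction_eq_zero hαβ ((hP.mul hden).mono (by norm_num)) (hmT ▸ hmT8) hx

theorem QuadRoot.mul_add_C_ne_zero (hθ : QuadRoot τ K θ) {p q : K[X]} (hp : p ≠ 0)
    (hP : ∀ s, p = C s → ∀ ω, P ω = s) (hQ : ∀ s, q = C s → ∀ ω, Q ω = s)
    (hPz : P * z = 1) (hy : (Q + d • z) * y = 1) : q * p + C (φ d) ≠ 0 := by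
  intro hzero
  let ω := hθ.point 0 1 one_ne_zero
  have hPω : P ω * z ω = 1 := congrFun hPz ω
  have hyω : (Q ω + φ d * z ω) * y ω = 1 := by
    simpa [Algebra.smul_def] using congrFun hy ω
  have hQPω : Q ω * P ω + φ d = 0 := by
    by_cases hd : d = 0
    · have hq : q = 0 := by simpa [hd, hp] using hzero
      rw [hQ 0 (by simp [hq]), hd, map_zero, zero_mul, add_zero]
    · have hunit : IsUnit (q * p) := by
        rw [eq_neg_of_add_eq_zero_left hzero, ← C_neg]
        exact isUnit_C.2 (by simpa using hd)
      obtain ⟨s, -, hs⟩ := Polynomial.isUnit_iff.1 (isUnit_of_mul_isUnit_right hunit)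
      obtain ⟨t, -, ht⟩ := Polynomial.isUnit_iff.1 (isUnit_of_mul_isUnit_left hunit)
      rw [hP s hs.symm, hQ t ht.symm]
      simpa [← hs, ← ht] using congrArg (eval 0) hzero
  refine one_ne_zero (α := K) ?_
  linear_combination (z ω * y ω) * hQPω - (Q ω * y ω) * hPω - hyω

end MulInv

theorem QuadRoot.normQuotient_notMem_of_mul_inv (hθ : QuadRoot τ K θ) (hαβ : α ≠ 0 ∨ β ≠ 0)
    {P : FieldPoint τ K → K}
    (hP : P ∈ span k {1, fieldA, fieldB} ⊔ span k {linearForm l₁ l₂ * linearForm m₁ m₂})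
    (hPz : P * z = 1)
    (hy : IsProdOrInv (span k {1, fieldA, fieldB} ⊔
      span k {linearForm l₁ l₂ * linearForm m₁ m₂} ⊔ span k {z}) y) :
    normQuotient α β ∉ span k {1, fieldA, fieldB} ⊔
      span k {linearForm l₁ l₂ * linearForm m₁ m₂} ⊔ span k {z} ⊔ span k {y} := by
  intro hT
  obtain ⟨p, hpdeg, hPp, hPconst⟩ := hθ.exists_restrictsTo_eval hP
  have hp : p ≠ 0 := by
    rintro rfl
    have hPω := congrFun hPz (hθ.point 0 1 one_ne_zero)
    simp [hPconst 0 (by simp)] at hPω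
  obtain ⟨_, hwz, c, hT⟩ := mem_sup_span_singleton.1 hT
  obtain ⟨w, hw, e, rfl⟩ := mem_sup_span_singleton.1 hwz
  obtain ⟨_, -, hww, -⟩ := hθ.exists_restrictsTo_eval hw
  rcases hy with ⟨_, hQz, _, hQz', rfl⟩ | ⟨_, hQz, hQy, -⟩
  · obtain ⟨Q, hQ, d, rfl⟩ := mem_sup_span_singleton.1 hQz
    obtain ⟨Q', hQ', d', rfl⟩ := mem_sup_span_singleton.1 hQz'
    obtain ⟨_, -, hQq, -⟩ := hθ.exists_restrictsTo_eval hQ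
    obtain ⟨_, -, hQq', -⟩ := hθ.exists_restrictsTo_eval hQ'
    exact hp (hθ.eq_zero_of_eval_eq_zero_of_ne_zero (by omega) fun x hx =>
      hθ.eq_zero_of_eq_add_smul_mul hαβ hPp hQq hQq' hww hPz hT hx)
  · obtain ⟨Q, hQ, d, rfl⟩ := mem_sup_span_singleton.1 hQz
    obtain ⟨q, hqdeg, hQq, hQconst⟩ := hθ.exists_restrictsTo_eval hQ
    have hdeg : (q * p + C (φ d)).natDegree ≤ 4 :=
      natDegree_add_le_of_degree_le (natDegree_mul_le_of_le hqdeg hpdeg) (by simp)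
    have hzero : p * (q * p + C (φ d)) = 0 :=
      hθ.eq_zero_of_eval_eq_zero_of_ne_zero
        ((natDegree_mul_le_of_le hpdeg hdeg).trans (by norm_num)) fun x hx => by
        simpa using hθ.mul_eq_zero_of_eq_add_smul_inv hαβ hPp hQq hww hPz hQy hT hx
    exact hθ.mul_add_C_ne_zero hp hPconst hQconst hPz hQy ((mul_eq_zero.1 hzero).resolve_left hp)

theorem QuadRoot.normQuotient_notMem_of_reach (hθ : QuadRoot τ K θ) (hαβ : α ≠ 0 ∨ β ≠ 0)
    {W : Submodule k (FieldPoint τ K → K)} (h : Reach (span k {1, fieldA, fieldB}) 3 W) :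
    normQuotient α β ∉ W := by
  cases h with | @step _ _ y h hy =>
  cases h with | @step _ _ z h hz =>
  cases h with | @step _ _ z₀ h hz₀ =>
  cases h
  have hle {u : FieldPoint τ K → K} (hu : z₀ ∈ span k {1, fieldA, fieldB} ⊔ span k {u}) :
      span k {1, fieldA, fieldB} ⊔ span k {z₀} ≤ span k {1, fieldA, fieldB} ⊔ span k {u} :=
    sup_le le_sup_left (span_le.2 (by simpa using hu))
  rcases hθ.mem_of_isProdOrInv hz₀ with hR | ⟨l₁, l₂, m₁, m₂, hLM⟩
  · refine fun hT => ?_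
    replace hy := hy.mono (sup_le_sup_right (hle hR) _)
    replace hT := sup_le_sup_right (sup_le_sup_right (hle hR) _) _ hT
    rcases hz with ⟨P, hP, Q, hQ, rfl⟩ | ⟨P, hP, hPz, -⟩
    · exact hθ.normQuotient_notMem_of_inv_mul hαβ (hle hR hP) (hle hR hQ) hy hT
    · exact hθ.normQuotient_notMem_of_inv_inv hαβ (hle hR hP) hPz hy hT
  · refine fun hT => ?_
    replace hy := hy.mono (sup_le_sup_right (hle hLM) _)
    replace hT := sup_le_sup_right (sup_le_sup_right (hle hLM) _) _ hT
    rcases hz with ⟨P, hP, Q, hQ, rfl⟩ | ⟨P, hP, hPz, -⟩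
    · exact hθ.normQuotient_notMem_of_mul_mul hαβ (hle hLM hP) (hle hLM hQ) hy hT
    · exact hθ.normQuotient_notMem_of_mul_inv hαβ (hle hLM hP) hPz hy hT

end ThreeSteps

section CheapPrograms

open Submodule

variable {k S Ω : Type*} [Field k] [Ring S] [Algebra k S] [Nonempty Ω] {l n : ℕ}
  {φ : Ω → S →ₐ[k] Matrix (Fin l) (Fin l) k} {Γ : SLP k} {τ : k} {a b r e : S}

theorem span_sub_smul_neg_smul (hτ : τ ≠ 0) :
    span k {1, b - τ⁻¹ • a, -(τ⁻¹ • a)} = span k {1, a, b} := by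
  apply le_antisymm <;> refine span_le.2 ?_ <;>
    simp only [Set.insert_subset_iff, Set.singleton_subset_iff, SetLike.mem_coe, mem_span_triple]
  · exact ⟨⟨1, 0, 0, by simp⟩, ⟨0, -τ⁻¹, 1, by module⟩, ⟨0, -τ⁻¹, 0, by module⟩⟩
  · exact ⟨⟨1, 0, 0, by simp⟩, ⟨0, 0, -τ, by simp [smul_smul, hτ]⟩, ⟨0, 1, -1, by module⟩⟩

theorem SLP.InvertsOn.exists_reach_T₂ (hΓ : Γ.InvertsOn τ (T₂ τ n)) (hτ : τ ≠ 0) (hln : l ≤ n)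
    (hφ : IsFaithfulFamily φ) (hr : b * r = 1) (he : (a * r * a - a + τ • b) * e = 1) :
    ∃ W, Reach (span k {1, a, b}) Γ.cost W ∧ (r * a - 1) * e ∈ W ∧ e ∈ W := by
  obtain ⟨t, ht, hc, hd⟩ := hΓ.exists_runIn_T₂_of_le hτ hln hφ hr he
  obtain ⟨W, hW, htW⟩ := ht.exists_reach_cost
  exact ⟨W, hW, htW _ hc, W.neg_mem_iff.1 (htW _ hd)⟩

-- The substitution `A ↦ B - τ⁻¹ A`, `B ↦ -τ⁻¹ A` carries `T₂` to `T₁`.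
theorem SLP.InvertsOn.exists_reach_T₁ (hΓ : Γ.InvertsOn τ (T₁ τ n)) (hτ : τ ≠ 0) (hln : l ≤ n)
    (hφ : IsFaithfulFamily φ) (hr : b * r = 1) (he : (a * r * a - a + τ • b) * e = 1) :
    ∃ W, Reach (span k {1, a, b}) Γ.cost W ∧ (r * a - 1) * e ∈ W ∧ e ∈ W := by
  have hsub : b - τ⁻¹ • a - -(τ⁻¹ • a) = b := by abel
  have hsum : b - τ⁻¹ • a + τ • (-(τ⁻¹ • a) * r * -(τ⁻¹ • a)) =
      τ⁻¹ • (a * r * a - a + τ • b) := by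
    simp only [neg_mul, mul_neg, smul_neg, neg_neg, smul_mul_assoc, mul_smul_comm, smul_smul,
      smul_add, smul_sub, inv_mul_cancel₀ hτ, one_smul, mul_inv_cancel_left₀ hτ]
    abel
  obtain ⟨t, ht, hc, hd⟩ := hΓ.exists_runIn_T₁_of_le hln hφ (e := τ • e) (hsub.symm ▸ hr)
    (by rw [hsum, smul_mul_smul_comm, he, inv_mul_cancel₀ hτ, one_smul])
  obtain ⟨W, hW, htW⟩ := ht.exists_reach_cost
  rw [span_sub_smul_neg_smul hτ] at hW
  have he : e ∈ W := (W.smul_mem_iff hτ).1 (htW _ hc)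
  have hcomp : (r * a - 1) * e = -(r * -(τ⁻¹ • a) * (τ • e)) - e := by simp [smul_smul, hτ, sub_mul]
  exact ⟨W, hW, hcomp ▸ W.sub_mem (htW _ hd) he, he⟩

theorem SLP.exists_reach_three (hΓ : Γ.InvertsOn τ (T₁ τ n) ∨ Γ.InvertsOn τ (T₂ τ n))
    (hcost : Γ.cost ≤ 4) (hτ : τ ≠ 0) (hln : l ≤ n) (hφ : IsFaithfulFamily φ) (hr : b * r = 1)
    (he : (a * r * a - a + τ • b) * e = 1) :
    ∃ (W : Submodule k S) (α β : k), Reach (span k {1, a, b}) 3 W ∧ (α ≠ 0 ∨ β ≠ 0) ∧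
      α • ((r * a - 1) * e) + β • e ∈ W := by
  obtain ⟨W, hW, hc, hd⟩ := hΓ.elim (·.exists_reach_T₁ hτ hln hφ hr he)
    (·.exists_reach_T₂ hτ hln hφ hr he)
  exact hW.exists_smul_add_smul_mem (subset_span (by simp)) hcost hc hd

end CheapPrograms

section LargeField

variable {k : Type*} [Field k] {τ : k} {n : ℕ}

theorem quadRoot_neg_xi [Fact (Irreducible (quadPoly τ))] {s : Finset k} (hs : 4 ≤ s.card) :
    QuadRoot τ (QuadExt τ) (-xi τ) where
  root := by linear_combination xi_mul_xi τ
  indep x y h := by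
    have hxy := (algebraMap_add_xi_mul_inj (τ := τ) (x := y) (y := -x) (x' := 0) (y' := 0)).1 (by
      simp only [map_neg, map_zero]
      linear_combination h)
    exact ⟨neg_eq_zero.1 hxy.2, hxy.1⟩
  card := by
    classical
    refine ⟨(s ×ˢ s).image fun p => algebraMap k (QuadExt τ) p.1 +
      xi τ * algebraMap k (QuadExt τ) p.2, ?_⟩
    rw [Finset.card_image_of_injective, Finset.card_product]
    · nlinarith
    · exact fun _ _ h => Prod.ext_iff.2 (algebraMap_add_xi_mul_inj.1 h)

theorem exists_injective_algHom_quadExt (hf : Irreducible (quadPoly τ)) :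
    ∃ ι : QuadExt τ →ₐ[k] Matrix (Fin 2) (Fin 2) k, Function.Injective ι := by
  let basis := (AdjoinRoot.powerBasis hf.ne_zero).basis.reindex (finCongr
    ((AdjoinRoot.powerBasis_dim hf.ne_zero).trans (natDegree_quadPoly τ)))
  exact ⟨Algebra.leftMulMatrix basis, Algebra.leftMulMatrix_injective basis⟩

section FieldAlgebra

variable {K : Type*} [Field K] [Algebra k K]

theorem fieldB_mul_fieldR : (fieldB : FieldPoint τ K → K) * fieldR = 1 :=
  funext fun ω => mul_inv_cancel₀ ω.2.2

theorem mul_sub_add_smul_mul_normQuotient :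
    (fieldA * fieldR * fieldA - fieldA + τ • fieldB : FieldPoint τ K → K) * normQuotient 0 1 =
      1 := by
  ext ω
  have hx := ω.2.2
  simp only [fieldA, fieldB, fieldR, normQuotient, Pi.add_apply, Pi.sub_apply, Pi.mul_apply,
    Pi.algebraMap_apply, Pi.one_apply, Algebra.smul_def, map_zero, map_one]
  rw [zero_mul, zero_add, mul_one_div, div_eq_one_iff_eq (mul_ne_zero ω.2.1 hx)]
  field_simp

theorem smul_add_smul_normQuotient (α β : k) :
    α • ((fieldR * fieldA - 1) * normQuotient 0 1) + β • normQuotient 0 1 =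
      (normQuotient α (β - α) : FieldPoint τ K → K) := by
  ext ω
  have hx := ω.2.2
  simp only [fieldA, fieldR, normQuotient, Pi.add_apply, Pi.sub_apply, Pi.mul_apply,
    Pi.algebraMap_apply, Pi.one_apply, Algebra.smul_def, map_zero, map_one, map_sub]
  field_simp
  ring

end FieldAlgebra

theorem five_le_cost_of_four_le_card (hf : Irreducible (quadPoly τ)) {s : Finset k}
    (hs : 4 ≤ s.card) (hn : 2 ≤ n) {Γ : SLP k}
    (hΓ : Γ.InvertsOn τ (T₁ τ n) ∨ Γ.InvertsOn τ (T₂ τ n)) : 5 ≤ Γ.cost := by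
  by_contra! hcost
  have : Fact (Irreducible (quadPoly τ)) := ⟨hf⟩
  have hθ := quadRoot_neg_xi (τ := τ) hs
  have : Nonempty (FieldPoint τ (QuadExt τ)) := ⟨hθ.point 0 1 one_ne_zero⟩
  obtain ⟨ι, hinj⟩ := exists_injective_algHom_quadExt hf
  have hunit (x : QuadExt τ) (hx : IsUnit (ι x)) : IsUnit x :=
    isUnit_iff_ne_zero.2 fun h => hx.ne_zero (by rw [h, map_zero])
  obtain ⟨W, α, β, hW, hαβ, hmem⟩ := SLP.exists_reach_three hΓ (Nat.le_of_lt_succ hcost)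
    (ne_zero_of_irreducible_quadPoly hf) hn (IsFaithfulFamily.pi_single hinj hunit)
    fieldB_mul_fieldR mul_sub_add_smul_mul_normQuotient
  rw [smul_add_smul_normQuotient] at hmem
  refine hθ.normQuotient_notMem_of_reach ?_ hW hmem
  by_cases hα : α = 0
  · exact .inr (by simpa [hα] using hαβ)
  · exact .inl hα

end LargeField

section Echelon

/-- `force n f = f n`. The kernel brings `n` to a literal before it unfolds `f`, so that no
unevaluated bit operation is ever duplicated. -/
def force {α : Type} (n : ℕ) (f : ℕ → α) : α := n.rec (f 0) fun m _ => f m.succ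

theorem force_eq {α : Type} (n : ℕ) (f : ℕ → α) : force n f = f n := by cases n <;> rfl

/-- Gaussian reduction of a bit vector: the entries `(p, v)` of the list are processed in order,
adding `v` whenever bit `p` is set. -/
def reduce (l : List (ℕ × ℕ)) : ℕ → ℕ :=
  l.rec (fun z => z) fun e _ ih z =>
    force (Nat.xor z (Nat.mul e.2 (Nat.land (Nat.shiftRight z e.1) 1))) ih

theorem reduce_cons (e : ℕ × ℕ) (l : List (ℕ × ℕ)) (z : ℕ) :
    reduce (e :: l) z = reduce l (z ^^^ e.2 * ((z >>> e.1) &&& 1)) := force_eq _ _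

theorem reduce_concat (l : List (ℕ × ℕ)) (e : ℕ × ℕ) (z : ℕ) :
    reduce (l ++ [e]) z = reduce l z ^^^ e.2 * ((reduce l z >>> e.1) &&& 1) := by
  induction l generalizing z with
  | nil => exact reduce_cons e [] z
  | cons e' l ih => rw [List.cons_append, reduce_cons, reduce_cons, ih]

theorem mul_xor_shiftRight_and_one (v x y p : ℕ) : v * (((x ^^^ y) >>> p) &&& 1) =
    (v * ((x >>> p) &&& 1)) ^^^ (v * ((y >>> p) &&& 1)) := by
  rw [Nat.shiftRight_xor_distrib, Nat.and_xor_distrib_right]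
  rcases Nat.mod_two_eq_zero_or_one (x >>> p) with hx | hx <;>
    rcases Nat.mod_two_eq_zero_or_one (y >>> p) with hy | hy <;>
    simp [Nat.and_one_is_mod, hx, hy]

theorem reduce_xor (l : List (ℕ × ℕ)) (x y : ℕ) :
    reduce l (x ^^^ y) = reduce l x ^^^ reduce l y := by
  induction l generalizing x y with
  | nil => rfl
  | cons e l ih =>
    rw [reduce_cons, reduce_cons, reduce_cons, ← ih, mul_xor_shiftRight_and_one]
    congr 1
    simp only [Nat.xor_assoc, Nat.xor_left_comm]

theorem reduce_concat_log2 (l : List (ℕ × ℕ)) (v : ℕ) :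
    reduce (l ++ [((reduce l v).log2, reduce l v)]) v = 0 := by
  rw [reduce_concat]
  generalize reduce l v = w
  by_cases hw : w = 0
  · simp [hw]
  · have hshift : w >>> w.log2 = 1 := by
      have hle := Nat.log2_self_le hw
      have hlt : w < 2 ^ (w.log2 + 1) := Nat.lt_log2_self
      rw [pow_succ] at hlt
      rw [Nat.shiftRight_eq_div_pow]
      exact Nat.div_eq_of_lt_le (by omega) (by omega)
    simp [hshift]

/-- Extends the reduction list `l` by the reduced vectors `vs`, each paired with its leading bit,
and passes the result to the continuation `f`. -/
def echelon {α : Type} (f : List (ℕ × ℕ) → α) : List ℕ → List (ℕ × ℕ) → α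
  | [], l => f l
  | v :: vs, l => force (reduce l v) fun w => force w.log2 fun p => echelon f vs (l ++ [(p, w)])

theorem exists_echelon_eq {α : Type} (f : List (ℕ × ℕ) → α) (vs : List ℕ) (l : List (ℕ × ℕ)) :
    ∃ l', echelon f vs l = f l' ∧ (∀ z, reduce l z = 0 → reduce l' z = 0) ∧
      ∀ v ∈ vs, reduce l' v = 0 := by
  induction vs generalizing l with
  | nil => exact ⟨l, rfl, fun _ h => h, by simp⟩
  | cons v vs ih =>
    obtain ⟨l', heq, hmono, hvs⟩ := ih (l ++ [((reduce l v).log2, reduce l v)])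
    refine ⟨l', by simpa only [echelon, force_eq] using heq, fun z hz => hmono z ?_,
      List.forall_mem_cons.2 ⟨hmono v (reduce_concat_log2 l v), hvs⟩⟩
    rw [reduce_concat, hz]
    simp

end Echelon

/-- Seventeen `2 × 2` matrices over the field with two elements, packed into four bit vectors: bit
`i` of `a`, `b`, `c`, `d` is an entry of matrix `i`, whose rows are `(a, b)` and `(c, d)`. The
operations below are spelled with `Nat.xor` and `Nat.land`, which the kernel evaluates natively. -/
structure PackedMatrix where
  a : ℕ
  b : ℕ
  c : ℕ
  d : ℕ

namespace PackedMatrix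

section Computation

/-- The entrywise sum. -/
def add (x y : PackedMatrix) : PackedMatrix :=
  ⟨Nat.xor x.a y.a, Nat.xor x.b y.b, Nat.xor x.c y.c, Nat.xor x.d y.d⟩

/-- The seventeen matrix products. -/
def mul (x y : PackedMatrix) : PackedMatrix :=
  ⟨Nat.xor (Nat.land x.a y.a) (Nat.land x.b y.c), Nat.xor (Nat.land x.a y.b) (Nat.land x.b y.d),
    Nat.xor (Nat.land x.c y.a) (Nat.land x.d y.c), Nat.xor (Nat.land x.c y.b) (Nat.land x.d y.d)⟩

/-- The adjugates; there are no signs in characteristic two. -/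
def adj (x : PackedMatrix) : PackedMatrix := ⟨x.d, x.b, x.c, x.a⟩

/-- The determinants, packed into one bit vector. -/
def det (x : PackedMatrix) : ℕ := Nat.xor (Nat.land x.a x.d) (Nat.land x.b x.c)

/-- The zero matrices. -/
def zero : PackedMatrix := ⟨0, 0, 0, 0⟩

/-- The identity matrices, with `131071 = 2 ^ 17 - 1`. -/
def one : PackedMatrix := ⟨131071, 0, 0, 131071⟩

/-- `x.forced f = f x`. The kernel evaluates the entries of `x` before it unfolds `f`. -/
def forced {α : Type} (x : PackedMatrix) (f : PackedMatrix → α) : α :=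
  force x.a fun a => force x.b fun b => force x.c fun c => force x.d fun d => f ⟨a, b, c, d⟩

theorem forced_eq {α : Type} (x : PackedMatrix) (f : PackedMatrix → α) : x.forced f = f x := by
  simp only [forced, force_eq]

/-- The sums of the sublists, that is, the elements of the span over the field with two elements. -/
def sums : List PackedMatrix → List PackedMatrix
  | [] => [zero]
  | b :: bs => sums bs ++ (sums bs).map b.add

/-- The inverses of the invertible elements in the span of `1` and `bs`. -/
def inverses (bs : List PackedMatrix) : List PackedMatrix :=
  ((sums (one :: bs)).filter fun p => Nat.beq p.det 131071).map adj

/-- The elements that one multiplication or inversion adds to the span of `1` and `bs`, up to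
elements of that span. -/
def steps (bs : List PackedMatrix) : List PackedMatrix :=
  ((sums bs).flatMap fun p => (sums bs).map p.mul) ++ inverses bs

/-- No element of `ts`, translated by `z`, reduces to zero. -/
def avoids (ts : List ℕ) (z : ℕ) (l : List (ℕ × ℕ)) : Bool :=
  ts.all fun t => !Nat.beq (reduce l (Nat.xor z t)) 0

/-- No bit vector in `ts` is an upper left entry after one further step from the span of `1` and
`bs`. The products `p * q` with `p` fixed are linear in `q`, so one elimination treats all `q`. -/
def stepAvoids (ts : List ℕ) (bs : List PackedMatrix) : Bool :=
  echelon (fun l => ((sums bs).all fun p => p.forced fun p =>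
      echelon (avoids ts 0) (bs.map fun x => (p.mul x).a) l) &&
    (inverses bs).all fun p => avoids ts p.a l) ((one :: bs).map a) []

/-- No bit vector in `ts` is an upper left entry after three steps from the span of `1`, `a`,
`b`. -/
def threeStepsAvoid (ts : List ℕ) (a b : PackedMatrix) : Bool :=
  (steps [a, b]).all fun x => x.forced fun x => (steps [x, a, b]).all fun y => y.forced fun y =>
    stepAvoids ts [y, x, a, b]

variable {ts : List ℕ} {t : ℕ} {l : List (ℕ × ℕ)} {bs : List PackedMatrix}
  {a b p x y : PackedMatrix}

theorem mul_add_a (p x y : PackedMatrix) : (p.mul (x.add y)).a = (p.mul x).a ^^^ (p.mul y).a := by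
  change (p.a &&& (x.a ^^^ y.a)) ^^^ (p.b &&& (x.c ^^^ y.c)) =
    ((p.a &&& x.a) ^^^ (p.b &&& x.c)) ^^^ ((p.a &&& y.a) ^^^ (p.b &&& y.c))
  simp only [Nat.and_xor_distrib_left, Nat.xor_assoc, Nat.xor_left_comm]

theorem reduce_eq_zero_of_mem_sums {F : PackedMatrix → ℕ}
    (hF : ∀ x y, F (x.add y) = F x ^^^ F y) (h : ∀ x ∈ bs, reduce l (F x) = 0)
    (hp : p ∈ sums bs) : reduce l (F p) = 0 := by
  induction bs generalizing p with
  | nil =>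
    obtain rfl : p = zero := List.mem_singleton.1 hp
    rw [show zero = zero.add zero from rfl, hF, reduce_xor, Nat.xor_self]
  | cons b bs ih =>
    obtain ⟨hb, hbs⟩ := List.forall_mem_cons.1 h
    rcases List.mem_append.1 hp with hp | hp
    · exact ih hbs hp
    · obtain ⟨q, hq, rfl⟩ := List.mem_map.1 hp
      rw [hF, reduce_xor, hb, ih hbs hq, Nat.xor_self]

theorem reduce_ne_zero_of_avoids {z : ℕ} (h : avoids ts z l = true) (ht : t ∈ ts) :
    reduce l (z ^^^ t) ≠ 0 := by
  intro hzero
  have havoid := List.all_eq_true.1 h t ht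
  rw [show reduce l (Nat.xor z t) = 0 from hzero] at havoid
  exact Bool.false_ne_true havoid

theorem exists_reduce_of_stepAvoids (h : stepAvoids ts bs = true) (ht : t ∈ ts) :
    (∃ l, (∀ x ∈ one :: bs, reduce l x.a = 0) ∧ ∀ p ∈ inverses bs, reduce l (p.a ^^^ t) ≠ 0) ∧
      ∀ p ∈ sums bs, ∃ l, (∀ x ∈ one :: bs, reduce l x.a = 0) ∧
        (∀ x ∈ bs, reduce l (p.mul x).a = 0) ∧ reduce l t ≠ 0 := by
  obtain ⟨l, hl, -, hzero⟩ := exists_echelon_eq (fun l => ((sums bs).all fun p => p.forced fun p =>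
      echelon (avoids ts 0) (bs.map fun x => (p.mul x).a) l) &&
    (inverses bs).all fun p => avoids ts p.a l) ((one :: bs).map PackedMatrix.a) []
  rw [stepAvoids, hl, Bool.and_eq_true, List.all_eq_true, List.all_eq_true] at h
  rw [List.forall_mem_map] at hzero
  refine ⟨⟨l, hzero, fun p hp => reduce_ne_zero_of_avoids (h.2 p hp) ht⟩, fun p hp => ?_⟩
  have hprod := h.1 p hp
  obtain ⟨l', hl', hmono, hzero'⟩ :=
    exists_echelon_eq (avoids ts 0) (bs.map fun x => (p.mul x).a) l
  rw [forced_eq, hl'] at hprod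
  refine ⟨l', fun x hx => hmono _ (hzero x hx), List.forall_mem_map.1 hzero', ?_⟩
  simpa only [Nat.zero_xor] using reduce_ne_zero_of_avoids hprod ht

theorem stepAvoids_of_threeStepsAvoid (h : threeStepsAvoid ts a b = true) (hx : x ∈ steps [a, b])
    (hy : y ∈ steps [x, a, b]) : stepAvoids ts [y, x, a, b] = true := by
  have hxy := List.all_eq_true.1 h x hx
  rw [forced_eq, List.all_eq_true] at hxy
  simpa only [forced_eq] using hxy y hy

/-- The entries are bit vectors of length seventeen, so that no bit is lost in unpacking. -/
def Bounded (x : PackedMatrix) : Prop :=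
  x.a < 2 ^ 17 ∧ x.b < 2 ^ 17 ∧ x.c < 2 ^ 17 ∧ x.d < 2 ^ 17

theorem Bounded.add (hx : x.Bounded) (hy : y.Bounded) : (x.add y).Bounded :=
  ⟨Nat.xor_lt_two_pow hx.1 hy.1, Nat.xor_lt_two_pow hx.2.1 hy.2.1,
    Nat.xor_lt_two_pow hx.2.2.1 hy.2.2.1, Nat.xor_lt_two_pow hx.2.2.2 hy.2.2.2⟩

theorem Bounded.mul (hy : y.Bounded) : (x.mul y).Bounded :=
  ⟨Nat.xor_lt_two_pow (Nat.and_lt_two_pow _ hy.1) (Nat.and_lt_two_pow _ hy.2.2.1),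
    Nat.xor_lt_two_pow (Nat.and_lt_two_pow _ hy.2.1) (Nat.and_lt_two_pow _ hy.2.2.2),
    Nat.xor_lt_two_pow (Nat.and_lt_two_pow _ hy.1) (Nat.and_lt_two_pow _ hy.2.2.1),
    Nat.xor_lt_two_pow (Nat.and_lt_two_pow _ hy.2.1) (Nat.and_lt_two_pow _ hy.2.2.2)⟩

theorem Bounded.adj (hx : x.Bounded) : x.adj.Bounded := ⟨hx.2.2.2, hx.2.1, hx.2.2.1, hx.1⟩

theorem Bounded.det_lt (hx : x.Bounded) : x.det < 2 ^ 17 :=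
  Nat.xor_lt_two_pow (Nat.and_lt_two_pow _ hx.2.2.2) (Nat.and_lt_two_pow _ hx.2.2.1)

theorem bounded_zero : zero.Bounded := by simp [Bounded, zero]

theorem bounded_one : one.Bounded := by simp [Bounded, one]

theorem bounded_of_mem_sums (h : ∀ x ∈ bs, x.Bounded) (hp : p ∈ sums bs) : p.Bounded := by
  induction bs generalizing p with
  | nil =>
    obtain rfl : p = zero := List.mem_singleton.1 hp
    exact bounded_zero
  | cons b bs ih =>
    obtain ⟨hb, hbs⟩ := List.forall_mem_cons.1 h
    rcases List.mem_append.1 hp with hp | hp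
    · exact ih hbs hp
    · obtain ⟨q, hq, rfl⟩ := List.mem_map.1 hp
      exact hb.add (ih hbs hq)

theorem bounded_of_mem_one_cons (h : ∀ x ∈ bs, x.Bounded) : ∀ x ∈ one :: bs, x.Bounded :=
  List.forall_mem_cons.2 ⟨bounded_one, h⟩

theorem bounded_of_mem_inverses (h : ∀ x ∈ bs, x.Bounded) (hp : p ∈ inverses bs) :
    p.Bounded := by
  obtain ⟨q, hq, rfl⟩ := List.mem_map.1 hp
  exact (bounded_of_mem_sums (bounded_of_mem_one_cons h) (List.mem_filter.1 hq).1).adj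

theorem bounded_of_mem_steps (h : ∀ x ∈ bs, x.Bounded) (hp : p ∈ steps bs) : p.Bounded := by
  rcases List.mem_append.1 hp with hp | hp
  · obtain ⟨_, -, hp⟩ := List.mem_flatMap.1 hp
    obtain ⟨q, hq, rfl⟩ := List.mem_map.1 hp
    exact (bounded_of_mem_sums h hq).mul
  · exact bounded_of_mem_inverses h hp

end Computation

section Unpack

variable (k : Type*) [Field k]

/-- Bit `i` of `z` as an element of `k`. -/
def bitVal (z i : ℕ) : k := if z.testBit i then 1 else 0

/-- The seventeen matrices over `k` given by a packed matrix. -/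
def unpack (x : PackedMatrix) : Fin 17 → Matrix (Fin 2) (Fin 2) k := fun i =>
  !![bitVal k x.a i, bitVal k x.b i; bitVal k x.c i, bitVal k x.d i]

theorem bitVal_land (x y i : ℕ) : bitVal k (Nat.land x y) i = bitVal k x i * bitVal k y i := by
  change bitVal k (x &&& y) i = _
  simp only [bitVal, Nat.testBit_and]
  cases x.testBit i <;> cases y.testBit i <;> simp

theorem bitVal_mask (i : Fin 17) : bitVal k 131071 i = 1 := by
  have : (131071 : ℕ).testBit i = true := by revert i; decide
  simp [bitVal, this]

theorem bitVal_zero (i : ℕ) : bitVal k 0 i = 0 := by simp [bitVal]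

theorem unpack_zero : unpack k zero = 0 := by
  ext i p q
  fin_cases p <;> fin_cases q <;> exact bitVal_zero k i

theorem unpack_one : unpack k one = 1 := by
  funext i
  simp only [unpack, one, bitVal_mask, bitVal_zero, Pi.one_apply, Matrix.one_fin_two]

variable {k} {x y : PackedMatrix} {z : Fin 17 → Matrix (Fin 2) (Fin 2) k}

theorem eq_of_bitVal_eq {x y : ℕ} (hx : x < 2 ^ 17) (hy : y < 2 ^ 17)
    (h : ∀ i : Fin 17, bitVal k x i = bitVal k y i) : x = y := by
  refine Nat.eq_of_testBit_eq fun i => ?_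
  by_cases hi : i < 17
  · have hbit := h ⟨i, hi⟩
    simp only [bitVal] at hbit
    cases hx' : x.testBit i <;> cases hy' : y.testBit i <;> simp_all
  · have hle : 2 ^ 17 ≤ 2 ^ i := Nat.pow_le_pow_right (by norm_num) (by omega)
    rw [Nat.testBit_lt_two_pow (hx.trans_le hle), Nat.testBit_lt_two_pow (hy.trans_le hle)]

theorem a_eq_of_unpack_eq (hx : x.Bounded) (hy : y.Bounded) (h : unpack k x = unpack k y) :
    x.a = y.a :=
  eq_of_bitVal_eq hx.1 hy.1 fun i => by
    simpa [unpack] using congrFun (congrFun (congrFun h i) 0) 0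

variable [CharP k 2]

theorem bitVal_xor (x y i : ℕ) : bitVal k (Nat.xor x y) i = bitVal k x i + bitVal k y i := by
  change bitVal k (x ^^^ y) i = _
  simp only [bitVal, Nat.testBit_xor]
  cases x.testBit i <;> cases y.testBit i <;> simp [CharTwo.add_self_eq_zero]

theorem unpack_add (x y : PackedMatrix) : unpack k (x.add y) = unpack k x + unpack k y := by
  ext i p q
  fin_cases p <;> fin_cases q <;> exact bitVal_xor _ _ i

theorem unpack_mul (x y : PackedMatrix) : unpack k (x.mul y) = unpack k x * unpack k y := by
  funext i
  simp only [unpack, mul, bitVal_xor, bitVal_land, Pi.mul_apply, Matrix.mul_fin_two]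

theorem unpack_sub (x y : PackedMatrix) : unpack k x - unpack k y = unpack k (x.add y) := by
  rw [unpack_add]
  ext i p q
  exact CharTwo.sub_eq_add _ _

theorem det_unpack (x : PackedMatrix) (i : Fin 17) :
    (unpack k x i).det = bitVal k x.det i := by
  simp only [unpack, Matrix.det_fin_two_of, det, bitVal_xor, bitVal_land, CharTwo.sub_eq_add]

theorem unpack_adj (x : PackedMatrix) (i : Fin 17) :
    unpack k x.adj i = (unpack k x i).adjugate := by
  simp only [unpack, adj, Matrix.adjugate_fin_two_of, CharTwo.neg_eq]

theorem det_eq_of_unpack_mul_eq_one (hx : x.Bounded) (h : unpack k x * z = 1) :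
    x.det = 131071 := by
  refine eq_of_bitVal_eq (k := k) hx.det_lt (by norm_num) fun i => ?_
  have hdet : bitVal k x.det i * (z i).det = 1 := by
    rw [← det_unpack, ← Matrix.det_mul, ← Pi.mul_apply, h, Pi.one_apply, Matrix.det_one]
  rw [bitVal_mask]
  exact ite_eq_left_iff.2 fun hbit => by simp [bitVal, hbit] at hdet

theorem eq_unpack_adj (hx : x.det = 131071) (h : unpack k x * z = 1) : z = unpack k x.adj := by
  refine (left_inv_eq_right_inv ?_ h).symm
  funext i
  rw [Pi.mul_apply, unpack_adj, Matrix.adjugate_mul, det_unpack, hx, bitVal_mask, one_smul,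
    Pi.one_apply]

end Unpack

section Span

open Submodule

variable (k : Type*) [Field k]

/-- The span over `k` of the unpacked matrices. -/
def packedSpan : List PackedMatrix → Submodule k (Fin 17 → Matrix (Fin 2) (Fin 2) k)
  | [] => ⊥
  | b :: bs => packedSpan bs ⊔ span k {unpack k b}

variable {k} {ts : List ℕ} {bs : List PackedMatrix} {a b p t : PackedMatrix}
  {f g w z : Fin 17 → Matrix (Fin 2) (Fin 2) k}
  {W : Submodule k (Fin 17 → Matrix (Fin 2) (Fin 2) k)}

theorem unpack_mem_packedSpan (hp : p ∈ bs) : unpack k p ∈ packedSpan k bs := by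
  induction bs with
  | nil => exact absurd hp List.not_mem_nil
  | cons b bs ih =>
    rcases List.mem_cons.1 hp with rfl | hp
    · exact mem_sup_right (mem_span_singleton_self _)
    · exact mem_sup_left (ih hp)

theorem one_mem_packedSpan_one_cons : 1 ∈ packedSpan k (one :: bs) :=
  unpack_one k ▸ unpack_mem_packedSpan List.mem_cons_self

theorem exists_mul_eq_of_mem_packedSpan (hf : f ∈ packedSpan k (one :: bs))
    (hg : g ∈ packedSpan k (one :: bs)) :
    ∃ f' ∈ packedSpan k bs, ∃ g' ∈ packedSpan k bs, ∃ w ∈ packedSpan k (one :: bs),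
      f * g = w + f' * g' := by
  rw [packedSpan, mem_sup_span_singleton, unpack_one] at hf hg
  obtain ⟨f', hf', c, rfl⟩ := hf
  obtain ⟨g', hg', d, rfl⟩ := hg
  refine ⟨f', hf', g', hg', d • f' + c • g' + (c * d) • 1,
    add_mem (add_mem (smul_mem _ _ (mem_sup_left hf')) (smul_mem _ _ (mem_sup_left hg')))
      (smul_mem _ _ one_mem_packedSpan_one_cons), ?_⟩
  simp only [add_mul, mul_add, smul_mul_assoc, mul_smul_comm, one_mul, mul_one, smul_add,
    smul_smul]
  module

variable [CharP k 2]

theorem exists_mem_sums_of_mem_packedSpan (hk : ∀ x : k, x = 0 ∨ x = 1)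
    (hg : g ∈ packedSpan k bs) : ∃ p ∈ sums bs, g = unpack k p := by
  induction bs generalizing g with
  | nil => exact ⟨zero, List.mem_singleton_self _, by rwa [unpack_zero, ← mem_bot k]⟩
  | cons b bs ih =>
    obtain ⟨w, hw, c, rfl⟩ := mem_sup_span_singleton.1 hg
    obtain ⟨p, hp, rfl⟩ := ih hw
    rcases hk c with rfl | rfl
    · exact ⟨p, List.mem_append_left _ hp, by rw [zero_smul, add_zero]⟩
    · exact ⟨b.add p, List.mem_append_right _ (List.mem_map_of_mem hp),
        by rw [one_smul, unpack_add, add_comm]⟩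

theorem exists_mem_inverses_of_mul_eq_one (hk : ∀ x : k, x = 0 ∨ x = 1)
    (hbs : ∀ x ∈ bs, x.Bounded) (hg : g ∈ packedSpan k (one :: bs)) (h : g * z = 1) :
    ∃ p ∈ inverses bs, z = unpack k p := by
  obtain ⟨p, hp, rfl⟩ := exists_mem_sums_of_mem_packedSpan hk hg
  have hdet := det_eq_of_unpack_mul_eq_one
    (bounded_of_mem_sums (bounded_of_mem_one_cons hbs) hp) h
  exact ⟨p.adj, List.mem_map_of_mem (List.mem_filter.2 ⟨hp, by rw [hdet]; rfl⟩),
    eq_unpack_adj hdet h⟩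

theorem exists_mem_steps_of_isProdOrInv (hk : ∀ x : k, x = 0 ∨ x = 1)
    (hbs : ∀ x ∈ bs, x.Bounded) (hz : IsProdOrInv (packedSpan k (one :: bs)) z) :
    ∃ y ∈ steps bs, ∃ w ∈ packedSpan k (one :: bs), z = w + unpack k y := by
  rcases hz with ⟨f, hf, g, hg, rfl⟩ | ⟨f, hf, hfz, -⟩
  · obtain ⟨f', hf', g', hg', w, hw, hfg⟩ := exists_mul_eq_of_mem_packedSpan hf hg
    obtain ⟨p, hp, rfl⟩ := exists_mem_sums_of_mem_packedSpan hk hf'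
    obtain ⟨q, hq, rfl⟩ := exists_mem_sums_of_mem_packedSpan hk hg'
    exact ⟨p.mul q, List.mem_append_left _ (List.mem_flatMap.2 ⟨p, hp, List.mem_map_of_mem hq⟩),
      w, hw, by rw [hfg, unpack_mul]⟩
  · obtain ⟨p, hp, rfl⟩ := exists_mem_inverses_of_mul_eq_one hk hbs hf hfz
    exact ⟨p, List.mem_append_right _ hp, 0, zero_mem _, (zero_add _).symm⟩

theorem exists_sup_span_le_packedSpan (hk : ∀ x : k, x = 0 ∨ x = 1) (hbs : ∀ x ∈ bs, x.Bounded)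
    (hW : W ≤ packedSpan k (one :: bs)) (hz : IsProdOrInv W z) :
    ∃ y ∈ steps bs, W ⊔ span k {z} ≤ packedSpan k (one :: y :: bs) := by
  obtain ⟨y, hy, w, hw, rfl⟩ := exists_mem_steps_of_isProdOrInv hk hbs (hz.mono hW)
  have hle : packedSpan k (one :: bs) ≤ packedSpan k (one :: y :: bs) :=
    sup_le_sup_right le_sup_left _
  exact ⟨y, hy, sup_le (hW.trans hle) ((span_singleton_le_iff_mem _ _).2
    (add_mem (hle hw) (unpack_mem_packedSpan (by simp))))⟩

theorem unpack_ne_add_mul_of_stepAvoids (hk : ∀ x : k, x = 0 ∨ x = 1)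
    (hbs : ∀ x ∈ bs, x.Bounded) (h : stepAvoids ts bs = true) (ht : t.Bounded) (hts : t.a ∈ ts)
    (hw : w ∈ packedSpan k (one :: bs)) (hf : f ∈ packedSpan k bs) (hg : g ∈ packedSpan k bs) :
    unpack k t ≠ w + f * g := by
  intro heq
  obtain ⟨v, hv, rfl⟩ := exists_mem_sums_of_mem_packedSpan hk hw
  obtain ⟨p, hp, rfl⟩ := exists_mem_sums_of_mem_packedSpan hk hf
  obtain ⟨q, hq, rfl⟩ := exists_mem_sums_of_mem_packedSpan hk hg
  obtain ⟨l, hone, hmul, hne⟩ := (exists_reduce_of_stepAvoids h hts).2 p hp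
  rw [← unpack_mul, ← unpack_add] at heq
  have hv_bounded := bounded_of_mem_sums (bounded_of_mem_one_cons hbs) hv
  have hta : t.a = v.a ^^^ (p.mul q).a :=
    a_eq_of_unpack_eq ht (hv_bounded.add (bounded_of_mem_sums hbs hq).mul) heq
  apply hne
  rw [hta, reduce_xor, reduce_eq_zero_of_mem_sums (F := PackedMatrix.a) (fun _ _ => rfl) hone hv,
    reduce_eq_zero_of_mem_sums (mul_add_a p) hmul hq, Nat.xor_self]

theorem unpack_ne_add_inverse_of_stepAvoids (hk : ∀ x : k, x = 0 ∨ x = 1)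
    (hbs : ∀ x ∈ bs, x.Bounded) (h : stepAvoids ts bs = true) (ht : t.Bounded) (hts : t.a ∈ ts)
    (hw : w ∈ packedSpan k (one :: bs)) (hp : p ∈ inverses bs) :
    unpack k t ≠ w + unpack k p := by
  intro heq
  obtain ⟨v, hv, rfl⟩ := exists_mem_sums_of_mem_packedSpan hk hw
  obtain ⟨l, hone, hne⟩ := (exists_reduce_of_stepAvoids h hts).1
  rw [← unpack_add] at heq
  have hv_bounded := bounded_of_mem_sums (bounded_of_mem_one_cons hbs) hv
  have hta : t.a = v.a ^^^ p.a :=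
    a_eq_of_unpack_eq ht (hv_bounded.add (bounded_of_mem_inverses hbs hp)) heq
  apply hne p hp
  rw [hta, Nat.xor_left_comm, Nat.xor_self, Nat.xor_zero,
    reduce_eq_zero_of_mem_sums (F := PackedMatrix.a) (fun _ _ => rfl) hone hv]

theorem unpack_notMem_of_stepAvoids (hk : ∀ x : k, x = 0 ∨ x = 1) (hbs : ∀ x ∈ bs, x.Bounded)
    (h : stepAvoids ts bs = true) (ht : t.Bounded) (hts : t.a ∈ ts)
    (hz : IsProdOrInv (packedSpan k (one :: bs)) z) :
    unpack k t ∉ packedSpan k (one :: bs) ⊔ span k {z} := by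
  rw [mem_sup_span_singleton]
  rintro ⟨w, hw, c, heq⟩
  rcases hk c with rfl | rfl
  · exact unpack_ne_add_mul_of_stepAvoids hk hbs h ht hts hw (zero_mem _) (zero_mem _)
      (by simpa using heq)
  rw [one_smul] at heq
  rcases hz with ⟨f, hf, g, hg, rfl⟩ | ⟨f, hf, hfz, -⟩
  · obtain ⟨f', hf', g', hg', w', hw', hfg⟩ := exists_mul_eq_of_mem_packedSpan hf hg
    rw [hfg, ← add_assoc] at heq
    exact unpack_ne_add_mul_of_stepAvoids hk hbs h ht hts (add_mem hw hw') hf' hg' heq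
  · obtain ⟨p, hp, rfl⟩ := exists_mem_inverses_of_mul_eq_one hk hbs hf hfz
    exact unpack_ne_add_inverse_of_stepAvoids hk hbs h ht hts hw hp heq

theorem unpack_notMem_of_threeStepsAvoid (hk : ∀ x : k, x = 0 ∨ x = 1) (ha : a.Bounded)
    (hb : b.Bounded) (h : threeStepsAvoid ts a b = true)
    (hW : Reach (span k {1, unpack k a, unpack k b}) 3 W) (ht : t.Bounded) (hts : t.a ∈ ts) :
    unpack k t ∉ W := by
  have hab : ∀ x ∈ [a, b], x.Bounded := by simp [ha, hb]
  obtain - | @⟨_, _, z₃, hW₂, hz₃⟩ := hW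
  obtain - | @⟨_, _, z₂, hW₁, hz₂⟩ := hW₂
  obtain - | @⟨_, _, z₁, hW₀, hz₁⟩ := hW₁
  cases hW₀
  have hle₀ : span k {1, unpack k a, unpack k b} ≤ packedSpan k [one, a, b] := by
    rw [span_le]
    rintro x (rfl | rfl | rfl)
    · exact one_mem_packedSpan_one_cons
    all_goals exact unpack_mem_packedSpan (by simp)
  obtain ⟨x, hx, hle₁⟩ := exists_sup_span_le_packedSpan hk hab hle₀ hz₁
  have hxab := List.forall_mem_cons.2 ⟨bounded_of_mem_steps hab hx, hab⟩
  obtain ⟨y, hy, hle₂⟩ := exists_sup_span_le_packedSpan hk hxab hle₁ hz₂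
  have hyxab := List.forall_mem_cons.2 ⟨bounded_of_mem_steps hxab hy, hxab⟩
  exact fun hmem => unpack_notMem_of_stepAvoids hk hyxab (stepAvoids_of_threeStepsAvoid h hx hy)
    ht hts (hz₃.mono hle₂) (sup_le_sup_right hle₂ _ hmem)

end Span

end PackedMatrix

section TwoElements

open PackedMatrix

variable {k : Type*} [Field k] [CharP k 2] {τ : k} {n : ℕ}

/-- The matrices `A` at seventeen points `(A, B)` of `T₂`, found by computer search so that
`threeStepsAvoid` holds. -/
def pointsA : PackedMatrix := ⟨72650, 12050, 120606, 118115⟩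

/-- The matrices `B` at the seventeen points. -/
def pointsB : PackedMatrix := ⟨47624, 90103, 131071, 123946⟩

/-- The inverses of `pointsB`. -/
def pointsR : PackedMatrix := ⟨123946, 90103, 131071, 47624⟩

/-- The values of `(A B⁻¹ A - A + B)⁻¹`. -/
def pointsE : PackedMatrix := ⟨126283, 24247, 128703, 113608⟩

/-- The values of `(B⁻¹ A - 1) (A B⁻¹ A - A + B)⁻¹`. -/
def pointsC : PackedMatrix := ((pointsR.mul pointsA).add one).mul pointsE

set_option maxRecDepth 100000 in
theorem threeStepsAvoid_points : threeStepsAvoid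
    [pointsE.a, pointsC.a, Nat.xor pointsC.a pointsE.a] pointsA pointsB = true := by
  decide +kernel

theorem bounded_pointsE : pointsE.Bounded := by simp [Bounded, pointsE]

theorem unpack_pointsB_mul_pointsR : unpack k pointsB * unpack k pointsR = 1 := by
  rw [← unpack_mul, ← unpack_one]
  rfl

theorem unpack_points_mul_pointsE :
    (unpack k pointsA * unpack k pointsR * unpack k pointsA - unpack k pointsA +
      (1 : k) • unpack k pointsB) * unpack k pointsE = 1 := by
  rw [one_smul, ← unpack_mul, ← unpack_mul, unpack_sub, ← unpack_add, ← unpack_mul, ← unpack_one]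
  rfl

theorem unpack_pointsC :
    (unpack k pointsR * unpack k pointsA - 1) * unpack k pointsE = unpack k pointsC := by
  rw [← unpack_mul, ← unpack_one, unpack_sub, ← unpack_mul, pointsC]

theorem five_le_cost_of_forall_eq (hk : ∀ x : k, x = 0 ∨ x = 1) (hτ : τ ≠ 0) (hn : 2 ≤ n)
    {Γ : SLP k} (hΓ : Γ.InvertsOn τ (T₁ τ n) ∨ Γ.InvertsOn τ (T₂ τ n)) : 5 ≤ Γ.cost := by
  by_contra! hcost
  obtain rfl : τ = 1 := (hk τ).resolve_left hτ
  obtain ⟨W, α, β, hW, hαβ, hmem⟩ := SLP.exists_reach_three hΓ (Nat.le_of_lt_succ hcost) hτ hn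
    (IsFaithfulFamily.pi_single (Ω := Fin 17) (ι := AlgHom.id k (Matrix (Fin 2) (Fin 2) k))
      Function.injective_id fun _ h => h) unpack_pointsB_mul_pointsR unpack_points_mul_pointsE
  rw [unpack_pointsC] at hmem
  have hnotMem {t : PackedMatrix} (ht : t.Bounded)
      (hts : t.a ∈ [pointsE.a, pointsC.a, Nat.xor pointsC.a pointsE.a]) : unpack k t ∉ W :=
    unpack_notMem_of_threeStepsAvoid hk (by simp [Bounded, pointsA]) (by simp [Bounded, pointsB])
      threeStepsAvoid_points hW ht hts
  have hC : pointsC.Bounded := bounded_pointsE.mul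
  rcases hk α with rfl | rfl <;> rcases hk β with rfl | rfl
  · simp at hαβ
  · rw [zero_smul, one_smul, zero_add] at hmem
    exact hnotMem bounded_pointsE (by simp) hmem
  · rw [zero_smul, one_smul, add_zero] at hmem
    exact hnotMem hC (by simp) hmem
  · rw [one_smul, one_smul, ← unpack_add] at hmem
    exact hnotMem (hC.add bounded_pointsE) (by simp [PackedMatrix.add]) hmem

end TwoElements

section Cost

variable {k : Type*} [Field k] {τ : k} {n : ℕ}

theorem charP_two_of_forall_eq (hk : ∀ x : k, x = 0 ∨ x = 1) : CharP k 2 := by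
  refine CharTwo.of_one_ne_zero_of_two_eq_zero one_ne_zero ((hk 2).resolve_right fun htwo => ?_)
  exact one_ne_zero (α := k) (by linear_combination htwo)

theorem forall_eq_or_exists_four_le_card (hk : Nat.card k ≠ 3) :
    (∀ x : k, x = 0 ∨ x = 1) ∨ ∃ s : Finset k, 4 ≤ s.card := by
  classical
  rcases finite_or_infinite k with hfin | hinf
  · have := Fintype.ofFinite k
    rw [Nat.card_eq_fintype_card] at hk
    have hlt := Fintype.one_lt_card (α := k)
    rcases lt_or_ge (Fintype.card k) 4 with hcard | hcard
    · have huniv : ({0, 1} : Finset k) = Finset.univ :=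
        Finset.eq_univ_of_card _ (by rw [Finset.card_pair zero_ne_one]; omega)
      exact .inl fun x => by simpa [← huniv] using Finset.mem_univ x
    · exact .inr ⟨Finset.univ, hcard⟩
  · obtain ⟨s, hs⟩ := Infinite.exists_subset_card_eq k 4
    exact .inr ⟨s, hs.ge⟩

theorem five_le_cost (hk : Nat.card k ≠ 3) (hf : Irreducible (quadPoly τ)) (hn : 2 ≤ n)
    {Γ : SLP k} (hΓ : Γ.InvertsOn τ (T₁ τ n) ∨ Γ.InvertsOn τ (T₂ τ n)) : 5 ≤ Γ.cost := by
  rcases forall_eq_or_exists_four_le_card hk with htwo | ⟨s, hs⟩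
  · have := charP_two_of_forall_eq htwo
    exact five_le_cost_of_forall_eq htwo (ne_zero_of_irreducible_quadPoly hf) hn hΓ
  · exact five_le_cost_of_four_le_card hf hs hn hΓ

theorem card_ne_three_of_charP_two (k : Type*) [Field k] [CharP k 2] : Nat.card k ≠ 3 := by
  intro hcard
  have : Finite k := Nat.finite_of_card_ne_zero (by omega)
  have := Fintype.ofFinite k
  rw [Nat.card_eq_fintype_card] at hcard
  have hthree : (3 : k) = 0 := by exact_mod_cast hcard ▸ Nat.cast_card_eq_zero k
  exact one_ne_zero (α := k) (by linear_combination hthree - CharTwo.two_eq_zero (R := k))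

end Cost

end FrobeniusInversion

end

open FrobeniusInversion in
theorem mainTheorem6_general {k : Type*} [Field k] (hk : Nat.card k ≠ 3) {τ : k}
    (hf : Irreducible (quadPoly τ)) {n : ℕ} (hn : 2 ≤ n) :
    ((frobeniusInversion τ).Inverts τ n ∧
      (progT₁ τ).InvertsOn τ (T₁ τ n) ∧ (progT₂ τ).InvertsOn τ (T₂ τ n) ∧
      (progT₁ τ).numInv = 2 ∧ (progT₁ τ).numMul = 3 ∧
      (progT₂ τ).numInv = 2 ∧ (progT₂ τ).numMul = 3) ∧
    IsLeast {c : ℕ | ∃ P : BranchingSLP k, P.Inverts τ n ∧ P.cost = c} 5 ∧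
    IsLeast {c : ℕ | ∃ Γ : SLP k, Γ.InvertsOn τ (T₁ τ n) ∧ Γ.cost = c} 5 ∧
    IsLeast {c : ℕ | ∃ Γ : SLP k, Γ.InvertsOn τ (T₂ τ n) ∧ Γ.cost = c} 5 ∧
    IsLeast {c : ℕ | ∃ Γ : SLP k, Γ.InvertsOn τ (T₁ τ n) ∧ Γ.numAdd = c} 2 ∧
    IsLeast {c : ℕ | ∃ Γ : SLP k, Γ.InvertsOn τ (T₂ τ n) ∧ Γ.numAdd = c} 2 ∧
    (progT₁ τ).numAdd = 2 ∧
    ((progT₂' τ).InvertsOn τ (T₂ τ n) ∧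
      (progT₂' τ).numInv = 2 ∧ (progT₂' τ).numMul = 3 ∧ (progT₂' τ).numAdd = 2) := by
  have hτ := ne_zero_of_irreducible_quadPoly hf
  refine ⟨⟨frobeniusInversion_inverts τ, progT₁_invertsOn τ, progT₂_invertsOn τ, rfl, rfl, rfl,
    rfl⟩, ⟨⟨frobeniusInversion τ, frobeniusInversion_inverts τ, rfl⟩, ?_⟩,
    ⟨⟨progT₁ τ, progT₁_invertsOn τ, rfl⟩, ?_⟩, ⟨⟨progT₂ τ, progT₂_invertsOn τ, rfl⟩, ?_⟩,
    ⟨⟨progT₁ τ, progT₁_invertsOn τ, rfl⟩, ?_⟩, ⟨⟨progT₂' τ, progT₂'_invertsOn τ, rfl⟩, ?_⟩, rfl,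
    progT₂'_invertsOn τ, rfl, rfl, rfl⟩
  · rintro _ ⟨P, hP, rfl⟩
    exact (five_le_cost hk hf hn (.inl hP.onT₁)).trans (le_max_left _ _)
  · rintro _ ⟨Γ, hΓ, rfl⟩
    exact five_le_cost hk hf hn (.inl hΓ)
  · rintro _ ⟨Γ, hΓ, rfl⟩
    exact five_le_cost hk hf hn (.inr hΓ)
  · rintro _ ⟨Γ, hΓ, rfl⟩
    exact two_le_numAdd_T₁ hΓ hτ hn
  · rintro _ ⟨Γ, hΓ, rfl⟩
    exact two_le_numAdd_T₂ hΓ hτ hn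

open FrobeniusInversion in
theorem mainTheorem6 {k : Type*} [Field k] [CharP k 2] (τ : k)
    (hf : Irreducible (quadPoly τ)) (n : ℕ) (hn : 2 ≤ n) :
    -- the algorithm inverts every matrix in `T₁ ∪ T₂`, each branch being correct on all of `Tᵢ`,
    -- with two inversions and three multiplications
    ((frobeniusInversion τ).Inverts τ n ∧
      (progT₁ τ).InvertsOn τ (T₁ τ n) ∧ (progT₂ τ).InvertsOn τ (T₂ τ n) ∧
      (progT₁ τ).numInv = 2 ∧ (progT₁ τ).numMul = 3 ∧
      (progT₂ τ).numInv = 2 ∧ (progT₂ τ).numMul = 3) ∧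
    -- five is the least total number of inversions and multiplications, for algorithms with the
    -- same branching and for straight-line programs on `T₁` alone and on `T₂` alone
    IsLeast {c : ℕ | ∃ P : BranchingSLP k, P.Inverts τ n ∧ P.cost = c} 5 ∧
    IsLeast {c : ℕ | ∃ Γ : SLP k, Γ.InvertsOn τ (T₁ τ n) ∧ Γ.cost = c} 5 ∧
    IsLeast {c : ℕ | ∃ Γ : SLP k, Γ.InvertsOn τ (T₂ τ n) ∧ Γ.cost = c} 5 ∧
    -- two is the least number of additions; on `T₂` it is attained, with two inversions and three
    -- multiplications, when the common term `X₂ - 1` is computed only once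
    IsLeast {c : ℕ | ∃ Γ : SLP k, Γ.InvertsOn τ (T₁ τ n) ∧ Γ.numAdd = c} 2 ∧
    IsLeast {c : ℕ | ∃ Γ : SLP k, Γ.InvertsOn τ (T₂ τ n) ∧ Γ.numAdd = c} 2 ∧
    (progT₁ τ).numAdd = 2 ∧
    ((progT₂' τ).InvertsOn τ (T₂ τ n) ∧
      (progT₂' τ).numInv = 2 ∧ (progT₂' τ).numMul = 3 ∧ (progT₂' τ).numAdd = 2) := by
  exact mainTheorem6_general (card_ne_three_of_charP_two k) hf hn
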